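/- **Setting.** An *S5-algebra* is a Boolean algebra with an operator $\Box$ such that $\Box 1=1$, $\Box(a\wedge b)=\Box a\wedge\Box b$, $\Box a\le a$, $\Box a\le\Box\Box a$ and $\neg\Box a\le\Box\neg\Box a$; homomorphisms are Boolean homomorphisms commuting with $\Box$. For $n>0$ write $\underline n$ for an $n$-element set and $P(\underline n)$ for the finite S5-algebra of all subsets of $\underline n$, where $\Box\,\underline n=\underline n$ and $\Box a=\emptyset$ for $a\neq\underline n$. For a surjection $f:\underline m\to\underline n$, taking preimages is a homomorphism $f^{-1}:P(\underline n)\to P(\underline m)$. Let $\mathcal L$ be the many-sorted language whose sorts are the positive integers, with one unary function symbol $f$, from sort $n$ to sort $m$, for every surjection $f:\underline m\to\underline n$. (Domains of sorts may be empty.) For $x$ of sort $n$, let $\mathrm{Fix}(x)=1$ abbreviate $\bigwedge\{\neg(\sigma(x)=x)\mid \sigma\in S_n\setminus\{1\}\}$. Consider the following axioms, in which all maps between the sets $\underline n$ are surjections. (1) $1(x)=x$ and $f(g(x))=(g\circ f)(x)$, for all $n>0$ and all $\underline r\xrightarrow{f}\underline m\xrightarrow{g}\underline n$. (2) For all $n>0$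 and $x$ of sort $n$: $\ \bigvee\{\exists y\,(f(y)=x\wedge \mathrm{Fix}(y)=1)\mid f:\underline n\to\underline m,\ m>0\}$. (3) For all $f:\underline k\to\underline n$, $g:\underline k\to\underline m$, and $x$ of sort $n$, $y$ of sort $m$: $\ (f(x)=g(y)\wedge \mathrm{Fix}(x)=1\wedge \mathrm{Fix}(y)=1)\to\bigvee\{\sigma(y)=x\mid \sigma:\underline n\to\underline m \text{ bijective},\ \sigma\circ f=g\}$. (5) For all $n>0$ and $x$ of sort $n$, there is exactly one $m$ with $1\le m\le n$ for which $\bigvee\{\exists y\,(f(y)=x\wedge \mathrm{Fix}(y)=1)\mid f:\underline n\to\underline m\}$ holds. (6) For all $q_1,q_2:\underline n\to\underline m$ and $x_1,x_2$ of sort $m$: $\ (q_1(x_1)=q_2(x_2)\wedge \mathrm{Fix}(x_1)=1\wedge \mathrm{Fix}(x_2)=1)\to\bigvee\{\sigma(x_1)=x_2\mid \sigma\in S_m,\ \sigma\circ q_2=q_1\}$. Let $T_1$ be the classical first-order $\mathcal L$-theory with axioms (1), (2), (3), and $T_2$ the one with axioms (1), (5), (6). If $M$ satisfies axiom (1), the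 symbols of permutations give actions of the groups $S_m$ on the domains $M_m$; let $a'_m$ be the restriction of the $m$-th action to $M'_m=\{x\in M_m\mid \mathrm{Fix}(x)=1\}$. The *canonical lifting* of an action $a$ of $S_m$ on $X$ is the $\mathcal L$-structure whose elements of sort $n$ are the classes $[x,q]$ of pairs with $x\in X$ and $q:\underline n\to\underline m$ surjective, where $[x_1,q_1]=[x_2,q_2]$ iff $a(\sigma,x_1)=x_2$ and $\sigma\circ q_2=q_1$ for some $\sigma\in S_m$, with $f([x,q])=[x,q\circ f]$. **Theorem.** (a) The category of finite S5-algebras (the one-element algebra included) has finite limits, and as a lex category it classifies the models of $T_2$ and their homomorphisms as $\mathcal L$-structures: sending a finite-limit-preserving functor $F$ from finite S5-algebras to sets to the $\mathcal L$-structure with domains $F(P(\underline n))$ and function symbols $f$ interpreted by $F(f^{-1})$ defines, up to natural isomorphism, an equivalence between the category of these functors, with natural transformations, and the category of models of $T_2$, with all homomorphisms of $\mathcal L$-structures. (b) An $\mathcal L$-structure is a model of $T_1$ if and only if it is a model of $T_2$. (c) An $\mathcal L$-structure $M$ is a model of $T_2$ if and only if it satisfies axiom (1) and is the disjoint union of the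 canonical liftings of its faithful parts $a'_m$, $m\ge 1$; that is, there is an isomorphism of $\mathcal L$-structures from the disjoint union of these liftings to $M$ that sends $[x,1]$ to $x$ for all $m\geq 1$ and $x\in M'_m$. -/

import Mathlib

open CategoryTheory

universe u v

namespace S5

/-! ### Surjections between the finite sets `{1, …, n}`, for `n` positive -/

/-- The surjective functions from an `m`-element set to an `n`-element set, for `m, n > 0`. -/
abbrev Surj (m n : ℕ+) : Type := {f : Fin m → Fin n // Function.Surjective f}

namespace Surj

/-- The identity surjection. -/
def id (n : ℕ+) : Surj n n := ⟨_root_.id, Function.surjective_id⟩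

/-- `g.comp f` is `g ∘ f`. -/
def comp {r m n : ℕ+} (g : Surj m n) (f : Surj r m) : Surj r n :=
  ⟨g.1 ∘ f.1, g.2.comp f.2⟩

/-- A bijection, seen as a surjection. -/
def ofEquiv {m n : ℕ+} (σ : Fin m ≃ Fin n) : Surj m n := ⟨σ, σ.surjective⟩

end Surj

/-! ### Structures for the many-sorted language `L`

The sorts are the positive natural numbers; every surjection `f` from an `m`-element set to an
`n`-element set is a unary function symbol, which takes arguments of sort `n` to values of
sort `m`. -/

/-- An `L`-structure. The domains of the sorts may be empty. -/
structure LStr where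
  /-- The domain of each sort. -/
  carrier : ℕ+ → Type u
  /-- The interpretation of each function symbol. -/
  map : ∀ {m n : ℕ+}, Surj m n → carrier n → carrier m

namespace LStr

/-- Homomorphisms of `L`-structures. -/
@[ext]
structure Hom (M N : LStr.{u}) where
  /-- The component at each sort. -/
  app : ∀ n : ℕ+, M.carrier n → N.carrier n
  /-- The components commute with the interpretations of the function symbols. -/
  comm : ∀ {m n : ℕ+} (f : Surj m n) (x : M.carrier n), app m (M.map f x) = N.map f (app n x)

instance : Category LStr.{u} where
  Hom := Hom
  id M := ⟨fun _ x => x, fun _ _ => rfl⟩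
  comp φ ψ := ⟨fun n x => ψ.app n (φ.app n x), fun f x => by rw [φ.comm, ψ.comm]⟩

end LStr

/-! ### Classical first-order logic over `L` -/

/-- `Var Γ n` is the type of variables of sort `n` in the context `Γ` (a list of sorts). -/
inductive Var : List ℕ+ → ℕ+ → Type
  | zero {Γ : List ℕ+} {n : ℕ+} : Var (n :: Γ) n
  | succ {Γ : List ℕ+} {n k : ℕ+} : Var Γ n → Var (k :: Γ) n

/-- Terms in context. -/
inductive Term (Γ : List ℕ+) : ℕ+ → Type
  | var {n : ℕ+} : Var Γ n → Term Γ n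
  | app {m n : ℕ+} : Surj m n → Term Γ n → Term Γ m

/-- First-order formulas in context. -/
inductive Formula : List ℕ+ → Type
  | falsum {Γ : List ℕ+} : Formula Γ
  | eq {Γ : List ℕ+} {n : ℕ+} : Term Γ n → Term Γ n → Formula Γ
  | imp {Γ : List ℕ+} : Formula Γ → Formula Γ → Formula Γ
  | all {Γ : List ℕ+} (n : ℕ+) : Formula (n :: Γ) → Formula Γ

namespace Formula

variable {Γ : List ℕ+}

/-- Negation. -/
def not (φ : Formula Γ) : Formula Γ := φ.imp falsum

/-- Disjunction. -/
def or (φ ψ : Formula Γ) : Formula Γ := φ.not.imp ψ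

/-- Conjunction. -/
def and (φ ψ : Formula Γ) : Formula Γ := (φ.imp ψ.not).not

/-- Existential quantification over a variable of sort `n`. -/
def ex (n : ℕ+) (φ : Formula (n :: Γ)) : Formula Γ := (all n φ.not).not

/-- Disjunction of a finite family of formulas; the empty disjunction is `falsum`. -/
noncomputable def bigOr {ι : Type} (s : Finset ι) (φ : ι → Formula Γ) : Formula Γ :=
  (s.toList.map φ).foldr or falsum

/-- Conjunction of a finite family of formulas; the empty conjunction is true. -/
noncomputable def bigAnd {ι : Type} (s : Finset ι) (φ : ι → Formula Γ) : Formula Γ :=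
  (s.toList.map φ).foldr and falsum.not

open Classical in
/-- Exclusive disjunction of a finite family of formulas: exactly one of them holds. -/
noncomputable def bigXor {ι : Type} (s : Finset ι) (φ : ι → Formula Γ) : Formula Γ :=
  bigOr s fun i => and (φ i) (bigAnd (s.erase i) fun j => (φ j).not)

end Formula

/-- A valuation in `M` of the variables of a context. -/
abbrev Env (M : LStr.{u}) (Γ : List ℕ+) : Type u := ∀ n : ℕ+, Var Γ n → M.carrier n

/-- The valuation of the empty context. -/
def Env.nil (M : LStr.{u}) : Env M [] := fun _ i => nomatch i

/-- The extension of a valuation by the value `a` of a new variable. -/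
def Env.cons {M : LStr.{u}} {Γ : List ℕ+} {k : ℕ+} (a : M.carrier k) (ρ : Env M Γ) :
    Env M (k :: Γ)
  | _, .zero => a
  | _, .succ i => ρ _ i

/-- The value of a term. -/
def Term.val {M : LStr.{u}} {Γ : List ℕ+} (ρ : Env M Γ) : {n : ℕ+} → Term Γ n → M.carrier n
  | _, .var i => ρ _ i
  | _, .app f t => M.map f (t.val ρ)

/-- Truth of a formula under a valuation. -/
def Formula.Realize {M : LStr.{u}} : {Γ : List ℕ+} → Env M Γ → Formula Γ → Prop
  | _, _, .falsum => False
  | _, ρ, .eq s t => s.val ρ = t.val ρ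
  | _, ρ, .imp φ ψ => φ.Realize ρ → ψ.Realize ρ
  | _, ρ, .all n φ => ∀ a : M.carrier n, φ.Realize (Env.cons a ρ)

/-- Closed formulas. -/
abbrev Sentence : Type := Formula []

/-- A first-order theory over `L`. -/
abbrev Theory : Type := Set Sentence

/-- `M` is a model of `T`. -/
def LStr.Models (M : LStr.{u}) (T : Theory) : Prop :=
  ∀ φ ∈ T, Formula.Realize (Env.nil M) φ

/-- The category of models of `T`, with all homomorphisms of `L`-structures. -/
abbrev Theory.Mod (T : Theory) : Type (u + 1) :=
  ObjectProperty.FullSubcategory fun M : LStr.{u} => M.Models T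

/-! ### The theories `T₁` and `T₂` -/

section

open Formula

variable {Γ : List ℕ+}

/-- The last variable of the context. -/
def Term.x0 {n : ℕ+} : Term (n :: Γ) n := .var .zero

/-- The last but one variable of the context. -/
def Term.x1 {n k : ℕ+} : Term (k :: n :: Γ) n := .var (.succ .zero)

/-- The formula `Fix(t) = 1`: no permutation other than the identity fixes `t`. -/
noncomputable def fixTrivial {n : ℕ+} (t : Term Γ n) : Formula Γ :=
  bigAnd (Finset.univ.erase (1 : Equiv.Perm (Fin n))) fun σ =>
    (eq (.app (.ofEquiv σ) t) t).not

/-- The formula `⋁ {∃ y, f(y) = x ∧ Fix(y) = 1 | f : n ↠ m}`, with `x` the free variable. -/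
noncomputable def comesFrom (n m : ℕ+) : Formula [n] :=
  bigOr (Finset.univ : Finset (Surj n m)) fun f =>
    ex m (and (eq (.app f .x0) .x1) (fixTrivial .x0))

/-- Functoriality: `1(x) = x` and `f(g(x)) = (g ∘ f)(x)`. -/
def axFunctoriality : Theory :=
  {φ | (∃ n : ℕ+, φ = all n (eq (.app (.id n) .x0) .x0)) ∨
    ∃ (r m n : ℕ+) (f : Surj r m) (g : Surj m n),
      φ = all n (eq (.app f (.app g .x0)) (.app (g.comp f) .x0))}

/-- For every `n`: `∀ x : n, ⋁ {∃ y, f(y) = x ∧ Fix(y) = 1 | f : n ↠ m, m arbitrary}`.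
A surjection `n ↠ m` exists only if `m ≤ n`, so that the disjunction is finite. -/
def axGeneration : Theory :=
  {φ | ∃ n : ℕ+, φ = all n (bigOr (Finset.Icc 1 n) fun m => comesFrom n m)}

open Classical in
/-- For all `f : k ↠ n` and `g : k ↠ m`: `∀ x : n, ∀ y : m,
f(x) = g(y) ∧ Fix(x) = 1 ∧ Fix(y) = 1 → ⋁ {σ(y) = x | σ : n ≃ m, σ ∘ f = g}`. -/
def axUniqueness : Theory :=
  {φ | ∃ (k n m : ℕ+) (f : Surj k n) (g : Surj k m),
    φ = all n (all m (imp
      (and (eq (.app f .x1) (.app g .x0)) (and (fixTrivial .x1) (fixTrivial .x0)))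
      (bigOr (Finset.univ.filter fun σ : Fin n ≃ Fin m => (Surj.ofEquiv σ).comp f = g) fun σ =>
        eq (.app (.ofEquiv σ) .x0) .x1)))}

/-- For every `n`:
`∀ x : n, ⨁ (m ≤ n), ⋁ {∃ y, f(y) = x ∧ Fix(y) = 1 | f : n ↠ m}`. -/
def axDisjointUnion : Theory :=
  {φ | ∃ n : ℕ+, φ = all n (bigXor (Finset.Icc 1 n) fun m => comesFrom n m)}

open Classical in
/-- For all `q₁, q₂ : n ↠ m`: `∀ x₁ x₂ : m,
q₁(x₁) = q₂(x₂) ∧ Fix(x₁) = 1 ∧ Fix(x₂) = 1 → ⋁ {σ(x₁) = x₂ | σ ∈ Sₘ, σ ∘ q₂ = q₁}`. -/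
def axLifting : Theory :=
  {φ | ∃ (n m : ℕ+) (q₁ q₂ : Surj n m),
    φ = all m (all m (imp
      (and (eq (.app q₁ .x1) (.app q₂ .x0)) (and (fixTrivial .x1) (fixTrivial .x0)))
      (bigOr (Finset.univ.filter fun σ : Equiv.Perm (Fin m) => (Surj.ofEquiv σ).comp q₂ = q₁)
        fun σ => eq (.app (.ofEquiv σ) .x1) .x0)))}

/-- The theory `T₁`. -/
def T₁ : Theory := axFunctoriality ∪ axGeneration ∪ axUniqueness

/-- The theory `T₂`. -/
def T₂ : Theory := axFunctoriality ∪ axDisjointUnion ∪ axLifting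

end

/-! ### Disjoint unions of canonical liftings of the faithful parts -/

namespace LStr

/-- `M` is a presheaf on the category of nonempty finite sets and surjections. -/
structure IsPresheaf (M : LStr.{u}) : Prop where
  map_id : ∀ (n : ℕ+) (x : M.carrier n), M.map (.id n) x = x
  map_comp : ∀ {r m n : ℕ+} (f : Surj r m) (g : Surj m n) (x : M.carrier n),
    M.map f (M.map g x) = M.map (g.comp f) x

/-- The faithful part of the action of `Sₘ` on the domain of sort `m`: the elements that only the
identity fixes. -/
def FaithfulPart (M : LStr.{u}) (m : ℕ+) : Type u :=
  {x : M.carrier m // ∀ σ : Equiv.Perm (Fin m), M.map (.ofEquiv σ) x = x → σ = 1}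

/-- The action of `Sₘ` on the faithful part, given by the function symbols of the permutations. -/
def faithfulAction (M : LStr.{u}) (hM : M.IsPresheaf) (m : ℕ+) (σ : Equiv.Perm (Fin m))
    (x : M.FaithfulPart m) : M.FaithfulPart m :=
  ⟨M.map (.ofEquiv σ) x.1, fun τ h => by
    have h1 : M.map (.ofEquiv σ⁻¹) (M.map (.ofEquiv τ) (M.map (.ofEquiv σ) x.1)) = x.1 := by
      rw [h, hM.map_comp]
      have : (Surj.ofEquiv σ).comp (Surj.ofEquiv σ⁻¹) = .id m := by
        apply Subtype.ext; funext i; simp [Surj.comp, Surj.ofEquiv, Surj.id]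
      rw [this, hM.map_id]
    rw [hM.map_comp, hM.map_comp] at h1
    have h2 : σ * τ * σ⁻¹ = 1 := x.2 _ h1
    simpa using h2⟩

/-- The canonical lifting of an action `a` of `Sₘ` on `X`: its elements of sort `n` are the
classes `[x, q]` of pairs of an `x` in `X` and a surjection `q : n ↠ m`, where
`[x₁, q₁] = [x₂, q₂]` if `a(σ, x₁) = x₂` and `σ ∘ q₂ = q₁` for some `σ` in `Sₘ`;
function symbols act by `f([x, q]) = [x, q ∘ f]`.
As function symbols compose contravariantly, actions here satisfy
`a(σ, a(τ, x)) = a(τ ∘ σ, x)`. -/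
def canonicalLifting {m : ℕ+} {X : Type u} (a : Equiv.Perm (Fin m) → X → X) : LStr.{u} where
  carrier n := Quot fun p₁ p₂ : X × Surj n m =>
    ∃ σ : Equiv.Perm (Fin m), a σ p₁.1 = p₂.1 ∧ (Surj.ofEquiv σ).comp p₂.2 = p₁.2
  map f := Quot.map (fun p => (p.1, p.2.comp f)) (by
    rintro ⟨x₁, q₁⟩ ⟨x₂, q₂⟩ ⟨σ, h, rfl⟩
    exact ⟨σ, h, rfl⟩)

/-- The disjoint union of a family of `L`-structures. -/
def disjointUnion {ι : Type} (N : ι → LStr.{u}) : LStr.{u} where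
  carrier n := Σ i, (N i).carrier n
  map f x := ⟨x.1, (N x.1).map f x.2⟩

/-- `M` is the disjoint union of the canonical liftings of the faithful parts of its actions of
symmetric groups, via an isomorphism that extends the inclusions of the faithful parts. -/
def IsUnionOfLiftings (M : LStr.{u}) (hM : M.IsPresheaf) : Prop :=
  ∃ e : disjointUnion (fun m : ℕ+ => canonicalLifting (M.faithfulAction hM m)) ≅ M,
    ∀ (m : ℕ+) (x : M.FaithfulPart m), e.hom.app m ⟨m, Quot.mk _ (x, .id m)⟩ = x.1

end LStr

/-! ### Finite S5-algebras -/

/-- An S5-algebra: a Boolean algebra with an operator `□` that satisfies the S5 laws. -/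
class S5Algebra (A : Type v) extends BooleanAlgebra A where
  box : A → A
  box_top : box ⊤ = ⊤
  box_inf : ∀ a b : A, box (a ⊓ b) = box a ⊓ box b
  box_le : ∀ a : A, box a ≤ a
  box_le_box_box : ∀ a : A, box a ≤ box (box a)
  compl_box_le : ∀ a : A, (box a)ᶜ ≤ box (box a)ᶜ

/-- Finite S5-algebras (the one-element algebra included). -/
structure FinS5Alg where
  carrier : Type v
  [str : S5Algebra carrier]
  [fin : Finite carrier]

attribute [instance] FinS5Alg.str FinS5Alg.fin

namespace FinS5Alg

/-- Homomorphisms of S5-algebras. -/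
@[ext]
structure Hom (A B : FinS5Alg.{v}) where
  /-- The underlying homomorphism of Boolean algebras. -/
  toBoolHom : BoundedLatticeHom A.carrier B.carrier
  map_box : ∀ a : A.carrier, toBoolHom (S5Algebra.box a) = S5Algebra.box (toBoolHom a)

instance : Category FinS5Alg.{v} where
  Hom := Hom
  id A := ⟨BoundedLatticeHom.id _, fun _ => rfl⟩
  comp f g := ⟨g.toBoolHom.comp f.toBoolHom, fun a => by simp [f.map_box, g.map_box]⟩

end FinS5Alg

open Classical in
/-- The S5-algebra of all subsets of a set `X` (one equivalence class): `□ X = X`, and `□ a = ∅`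
for the other subsets. -/
noncomputable abbrev powersetS5 (X : Type v) : S5Algebra (Set X) where
  box a := if a = Set.univ then Set.univ else ∅
  box_top := by simp
  box_inf a b := by
    by_cases ha : a = Set.univ
    · simp [ha]
    · have hab : a ∩ b ≠ Set.univ := fun h =>
        ha (Set.univ_subset_iff.1 (h.symm.subset.trans Set.inter_subset_left))
      simp [ha, hab]
  box_le a := by by_cases ha : a = Set.univ <;> simp [ha]
  box_le_box_box a := by by_cases ha : a = Set.univ <;> simp [ha]
  compl_box_le a := by by_cases ha : a = Set.univ <;> simp [ha]

/-- The finite S5-algebra of all subsets of an `n`-element set. -/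
noncomputable def powAlg (n : ℕ+) : FinS5Alg.{v} :=
  @FinS5Alg.mk (Set (ULift.{v} (Fin n))) (powersetS5 _) inferInstance

/-- Taking preimages along a surjection is a homomorphism of S5-algebras. -/
noncomputable def preimageHom {m n : ℕ+} (f : Surj m n) : powAlg.{v} n ⟶ powAlg.{v} m :=
  @FinS5Alg.Hom.mk (powAlg.{v} n) (powAlg.{v} m)
    { toFun := fun a : Set (ULift.{v} (Fin n)) =>
        ({i | ULift.up (f.1 i.down) ∈ a} : Set (ULift.{v} (Fin m)))
      map_sup' := fun _ _ => rfl
      map_inf' := fun _ _ => rfl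
      map_top' := rfl
      map_bot' := rfl }
    (by
      intro (a : Set (ULift.{v} (Fin n)))
      have key : ({i : ULift.{v} (Fin m) | ULift.up (f.1 i.down) ∈ a} = Set.univ) ↔
          a = Set.univ := by
        constructor
        · intro h
          refine Set.eq_univ_of_forall fun j => ?_
          obtain ⟨i, hi⟩ := f.2 j.down
          have : ULift.up i ∈ {i : ULift.{v} (Fin m) | ULift.up (f.1 i.down) ∈ a} :=
            h ▸ Set.mem_univ _
          simpa [hi] using this
        · rintro rfl
          rfl
      change {i : ULift.{v} (Fin m) | ULift.up (f.1 i.down) ∈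
          (powersetS5 (ULift.{v} (Fin n))).box a} =
        (powersetS5 (ULift.{v} (Fin m))).box {i | ULift.up (f.1 i.down) ∈ a}
      by_cases ha : a = Set.univ
      · exact (congrArg (fun b : Set (ULift.{v} (Fin n)) => {i : ULift.{v} (Fin m) |
          ULift.up (f.1 i.down) ∈ b}) (if_pos ha)).trans (if_pos (key.2 ha)).symm
      · exact (congrArg (fun b : Set (ULift.{v} (Fin n)) => {i : ULift.{v} (Fin m) |
          ULift.up (f.1 i.down) ∈ b}) (if_neg ha)).trans (if_neg fun h => ha (key.1 h)).symm)

/-- The `L`-structure with domains `F(P(n))`, where `P(n)` is the powerset algebra of an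
`n`-element set, and with function symbols interpreted by the values of `F` at preimage maps;
functorially in `F`. -/
noncomputable def restrict : (FinS5Alg.{v} ⥤ Type u) ⥤ LStr.{u} where
  obj F :=
    { carrier := fun n => F.obj (powAlg n)
      map := fun f x => F.map (preimageHom f) x }
  map α := LStr.Hom.mk (fun n x => α.app (powAlg n) x) (fun f x => by simp)
  map_id _ := rfl
  map_comp _ _ := rfl

end S5

/-! Both theories describe the same presheaves on nonempty finite sets and surjections: every
element is the image of one that only the identity permutation fixes, and two such elements with a
common image differ by a compatible bijection (`models_T₁`, `models_T₂`). Part (c) says that under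
these conditions `[x, q] ↦ q(x)` is bijective, and that they can be read off from this bijection.
Choosing one fixed-point-free element per bijection class turns a model into a sum of representables
(`exists_iso_sumRepresentables`).

On the algebraic side, atoms that lie below the same values of `□` form classes, and a finite
S5-algebra is the product of the powerset algebras of its classes (`isLimitFan`). A homomorphism to
some `P(n)` is one of these projections followed by a preimage map (`exists_factor`). A lex functor
is thus determined by its restriction to the `P(n)` and preimage maps, and so are natural
transformations, in a full and faithful way.

The restriction of a lex functor is a model because two limits exist among the `P(n)`. The equalizer
of the preimage map of a permutation `σ ≠ 1` and the identity is `P` of the set of orbits, which is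
smaller; descending along it gives generation. The pullback of two preimage maps is `P` of the
pushout of the surjections, which gives uniqueness.

For essential surjectivity, the sum of the representables at `m i` extends to the functor that takes
an algebra to its labellings: dually, each atom gets a label `⟨i, j⟩`, and each class is mapped onto
all `j < m i` for a single `i`. Expressed by finitary conditions on elements, this is stable under
pullbacks, and on `P(n)` a labelling is a surjection to some `m i`. -/

namespace S5

/-! ### Semantics of the derived connectives -/

section Semantics

open Formula

variable {M : LStr.{u}} {Γ : List ℕ+} (ρ : Env M Γ)

@[simp] theorem realize_falsum : (falsum : Formula Γ).Realize ρ ↔ False := Iff.rfl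

@[simp] theorem realize_imp (φ ψ : Formula Γ) :
    (φ.imp ψ).Realize ρ ↔ (φ.Realize ρ → ψ.Realize ρ) := Iff.rfl

@[simp] theorem realize_eq {n : ℕ+} (s t : Term Γ n) :
    (Formula.eq s t).Realize ρ ↔ s.val ρ = t.val ρ := Iff.rfl

@[simp] theorem realize_all (n : ℕ+) (φ : Formula (n :: Γ)) :
    (all n φ).Realize ρ ↔ ∀ a : M.carrier n, φ.Realize (Env.cons a ρ) := Iff.rfl

@[simp] theorem realize_not (φ : Formula Γ) : φ.not.Realize ρ ↔ ¬ φ.Realize ρ := Iff.rfl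

@[simp] theorem realize_or (φ ψ : Formula Γ) :
    (φ.or ψ).Realize ρ ↔ φ.Realize ρ ∨ ψ.Realize ρ := by
  simp only [Formula.or, realize_imp, realize_not]; tauto

@[simp] theorem realize_and (φ ψ : Formula Γ) :
    (φ.and ψ).Realize ρ ↔ φ.Realize ρ ∧ ψ.Realize ρ := by
  simp only [Formula.and, realize_imp, realize_not]; tauto

@[simp] theorem realize_ex (n : ℕ+) (φ : Formula (n :: Γ)) :
    (ex n φ).Realize ρ ↔ ∃ a : M.carrier n, φ.Realize (Env.cons a ρ) := by
  simp only [ex, realize_not, realize_all, not_forall, not_not]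

@[simp] theorem realize_bigOr {ι : Type} (s : Finset ι) (φ : ι → Formula Γ) :
    (bigOr s φ).Realize ρ ↔ ∃ i ∈ s, (φ i).Realize ρ := by
  simp only [← Finset.mem_toList, bigOr]
  induction s.toList with
  | nil => simp
  | cons a l ih => simp [ih]

@[simp] theorem realize_bigAnd {ι : Type} (s : Finset ι) (φ : ι → Formula Γ) :
    (bigAnd s φ).Realize ρ ↔ ∀ i ∈ s, (φ i).Realize ρ := by
  simp only [← Finset.mem_toList, bigAnd]
  induction s.toList with
  | nil => simp
  | cons a l ih => simp [ih]

theorem realize_bigXor {ι : Type} (s : Finset ι) (φ : ι → Formula Γ) :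
    (bigXor s φ).Realize ρ ↔ ∃! i, i ∈ s ∧ (φ i).Realize ρ := by
  classical
  simp only [bigXor, realize_bigOr, realize_and, realize_bigAnd, realize_not, Finset.mem_erase]
  constructor
  · rintro ⟨i, hi, h, h'⟩
    refine ⟨i, ⟨hi, h⟩, fun j hj => ?_⟩
    by_contra hne
    exact h' j ⟨hne, hj.1⟩ hj.2
  · rintro ⟨i, ⟨hi, h⟩, h'⟩
    exact ⟨i, hi, h, fun j hj hφ => hj.1 (h' j ⟨hj.2, hφ⟩)⟩

@[simp] theorem val_app {m n : ℕ+} (f : Surj m n) (t : Term Γ n) :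
    (Term.app f t).val ρ = M.map f (t.val ρ) := rfl

@[simp] theorem val_x0 {n : ℕ+} (a : M.carrier n) :
    (Term.x0 : Term (n :: Γ) n).val (Env.cons a ρ) = a := rfl

@[simp] theorem val_x1 {n k : ℕ+} (a : M.carrier n) (b : M.carrier k) :
    (Term.x1 : Term (k :: n :: Γ) n).val (Env.cons b (Env.cons a ρ)) = a := rfl

/-- Only the identity permutation fixes `x`. -/
def LStr.FixTrivial (M : LStr.{u}) {n : ℕ+} (x : M.carrier n) : Prop :=
  ∀ σ : Equiv.Perm (Fin n), M.map (.ofEquiv σ) x = x → σ = 1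

@[simp] theorem realize_fixTrivial {n : ℕ+} (t : Term Γ n) :
    (fixTrivial t).Realize ρ ↔ M.FixTrivial (t.val ρ) := by
  simp only [fixTrivial, realize_bigAnd, Finset.mem_erase, Finset.mem_univ, and_true, realize_not,
    realize_eq, val_app, LStr.FixTrivial]
  exact forall_congr' fun σ => by tauto

/-- Some element of sort `m` that only the identity fixes is taken to `x` by a function symbol. -/
def LStr.ComesFrom (M : LStr.{u}) {n : ℕ+} (x : M.carrier n) (m : ℕ+) : Prop :=
  ∃ (f : Surj n m) (y : M.carrier m), M.map f y = x ∧ M.FixTrivial y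

@[simp] theorem realize_comesFrom {n m : ℕ+} (x : M.carrier n) :
    (comesFrom n m).Realize (Env.cons x (Env.nil M)) ↔ M.ComesFrom x m := by
  simp [comesFrom, LStr.ComesFrom]

end Semantics

/-! ### The axioms as conditions on structures -/

theorem Surj.le {m n : ℕ+} (f : Surj m n) : n ≤ m := by
  simpa using Fintype.card_le_of_surjective f.1 f.2

namespace LStr

/-- Every element comes from an element that only the identity fixes. -/
def IsGenerated (M : LStr.{u}) : Prop :=
  ∀ (n : ℕ+) (x : M.carrier n), ∃ m, M.ComesFrom x m

/-- Elements that only the identity fixes and with a common image differ by a bijection. -/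
def HasUniqueness (M : LStr.{u}) : Prop :=
  ∀ {k n m : ℕ+} (f : Surj k n) (g : Surj k m) (x : M.carrier n) (y : M.carrier m),
    M.map f x = M.map g y → M.FixTrivial x → M.FixTrivial y →
      ∃ σ : Fin n ≃ Fin m, (Surj.ofEquiv σ).comp f = g ∧ M.map (.ofEquiv σ) y = x

variable {M : LStr.{u}}

theorem models_union {T T' : Theory} : M.Models (T ∪ T') ↔ M.Models T ∧ M.Models T' :=
  ⟨fun h => ⟨fun φ hφ => h φ (.inl hφ), fun φ hφ => h φ (.inr hφ)⟩,
    fun h φ hφ => hφ.elim (h.1 φ) (h.2 φ)⟩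

theorem models_axFunctoriality : M.Models axFunctoriality ↔ M.IsPresheaf := by
  constructor
  · intro h
    exact ⟨fun n => h _ (.inl ⟨n, rfl⟩), fun f g => h _ (.inr ⟨_, _, _, f, g, rfl⟩)⟩
  · rintro h φ (⟨n, rfl⟩ | ⟨r, m, n, f, g, rfl⟩)
    · exact h.map_id n
    · exact h.map_comp f g

theorem models_axGeneration : M.Models axGeneration ↔ M.IsGenerated := by
  -- The bound on `m` costs nothing: a surjection from `n` to `m` forces it.
  have key : ∀ (n : ℕ+) (x : M.carrier n),
      (∃ m ∈ Finset.Icc 1 n, M.ComesFrom x m) ↔ ∃ m, M.ComesFrom x m := fun n x =>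
    ⟨fun ⟨m, _, h⟩ => ⟨m, h⟩, fun ⟨m, f, h⟩ => ⟨m, by simp [f.le], f, h⟩⟩
  simp only [Models, axGeneration, Set.mem_ofPred_eq, forall_exists_index, forall_eq_apply_imp_iff,
    realize_all, realize_bigOr, realize_comesFrom, key, IsGenerated]

theorem models_axDisjointUnion :
    M.Models axDisjointUnion ↔ ∀ (n : ℕ+) (x : M.carrier n), ∃! m, M.ComesFrom x m := by
  have key : ∀ (n : ℕ+) (x : M.carrier n) (m : ℕ+),
      (m ∈ Finset.Icc 1 n ∧ M.ComesFrom x m) ↔ M.ComesFrom x m := fun n x m =>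
    ⟨fun h => h.2, fun ⟨f, h⟩ => ⟨by simp [f.le], f, h⟩⟩
  simp only [Models, axDisjointUnion, Set.mem_ofPred_eq, forall_exists_index,
    forall_eq_apply_imp_iff, realize_all, realize_bigXor, realize_comesFrom, key]

theorem models_axUniqueness : M.Models axUniqueness ↔ M.HasUniqueness := by
  constructor
  · intro h k n m f g x y hxy hx hy
    simpa [hxy, hx, hy] using h _ ⟨k, n, m, f, g, rfl⟩ x y
  · rintro h _ ⟨k, n, m, f, g, rfl⟩
    simpa using fun x y hxy hx hy => h f g x y hxy hx hy

theorem models_axLifting : M.Models axLifting ↔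
    ∀ {n m : ℕ+} (q₁ q₂ : Surj n m) (x₁ x₂ : M.carrier m), M.map q₁ x₁ = M.map q₂ x₂ →
      M.FixTrivial x₁ → M.FixTrivial x₂ →
        ∃ σ : Equiv.Perm (Fin m), (Surj.ofEquiv σ).comp q₂ = q₁ ∧ M.map (.ofEquiv σ) x₁ = x₂ := by
  constructor
  · intro h n m f g x y hxy hx hy
    simpa [hxy, hx, hy] using h _ ⟨n, m, f, g, rfl⟩ x y
  · rintro h _ ⟨n, m, f, g, rfl⟩
    simpa using fun x y hxy hx hy => h f g x y hxy hx hy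

theorem models_T₁ : M.Models T₁ ↔ M.IsPresheaf ∧ M.IsGenerated ∧ M.HasUniqueness := by
  rw [T₁, models_union, models_union, models_axFunctoriality, models_axGeneration,
    models_axUniqueness, and_assoc]

/-- The bijection supplied by (3) makes the source sort in (5) unique. Conversely, (5) forces equal
sorts on the two elements in (3), which leaves (6). As (3) and (6) apply the permutation to opposite
elements, the two are swapped in both directions. -/
theorem models_T₁_iff_models_T₂ : M.Models T₁ ↔ M.Models T₂ := by
  rw [models_T₁, T₂, models_union, models_union, models_axFunctoriality, models_axDisjointUnion,
    models_axLifting, and_assoc]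
  refine and_congr_right fun _ => ⟨fun ⟨hg, hu⟩ => ⟨fun n x => ?_, ?_⟩,
    fun ⟨hd, hl⟩ => ⟨fun n x => (hd n x).exists, ?_⟩⟩
  · obtain ⟨m, f, y, hy, hfix⟩ := hg n x
    refine ⟨m, ⟨f, y, hy, hfix⟩, ?_⟩
    rintro m' ⟨f', y', hy', hfix'⟩
    obtain ⟨σ, -⟩ := hu f' f y' y (hy'.trans hy.symm) hfix' hfix
    simpa using Fintype.card_congr σ
  · intro n m q₁ q₂ x₁ x₂ h h₁ h₂
    obtain ⟨σ, hσ, hσ'⟩ := hu q₂ q₁ x₂ x₁ h.symm h₂ h₁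
    exact ⟨σ, hσ, hσ'⟩
  · intro k n m f g x y h hx hy
    obtain rfl : n = m := (hd k (M.map f x)).unique ⟨f, x, rfl, hx⟩ ⟨g, y, h.symm, hy⟩
    exact hl g f y x h.symm hy hx

theorem models_T₂ : M.Models T₂ ↔ M.IsPresheaf ∧ M.IsGenerated ∧ M.HasUniqueness :=
  models_T₁_iff_models_T₂.symm.trans models_T₁

end LStr

/-! ### Disjoint unions of canonical liftings -/

namespace LStr

@[ext]
theorem hom_ext {M N : LStr.{u}} {φ ψ : M ⟶ N} (h : ∀ n x, φ.app n x = ψ.app n x) : φ = ψ :=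
  Hom.ext (funext fun n => funext fun x => h n x)

@[simp] theorem id_app (M : LStr.{u}) (n : ℕ+) (x : M.carrier n) : Hom.app (𝟙 M) n x = x := rfl

@[simp] theorem comp_app {M N K : LStr.{u}} (φ : M ⟶ N) (ψ : N ⟶ K) (n : ℕ+) (x : M.carrier n) :
    (φ ≫ ψ).app n x = ψ.app n (φ.app n x) := rfl

/-- A bijective homomorphism is an isomorphism. -/
noncomputable def isoOfBijective {M N : LStr.{u}} (φ : M ⟶ N)
    (h : ∀ n, Function.Bijective (φ.app n)) : M ≅ N where
  hom := φ
  inv := Hom.mk (fun n => (Equiv.ofBijective _ (h n)).symm) fun {m n} f x => by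
    rw [Equiv.symm_apply_eq, Equiv.ofBijective_apply, φ.comm]
    congr 1
    exact ((Equiv.ofBijective _ (h n)).apply_symm_apply x).symm
  hom_inv_id := hom_ext fun n x => (Equiv.ofBijective _ (h n)).symm_apply_apply x
  inv_hom_id := hom_ext fun n x => (Equiv.ofBijective _ (h n)).apply_symm_apply x

theorem bijective_of_iso {M N : LStr.{u}} (e : M ≅ N) (n : ℕ+) :
    Function.Bijective (e.hom.app n) := by
  refine Function.bijective_iff_has_inverse.2 ⟨e.inv.app n, fun x => ?_, fun x => ?_⟩
  · rw [← comp_app, e.hom_inv_id, id_app]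
  · rw [← comp_app, e.inv_hom_id, id_app]

variable {M : LStr.{u}}

theorem IsPresheaf.map_symm_map (hM : M.IsPresheaf) {n m : ℕ+} (σ : Fin n ≃ Fin m)
    (x : M.carrier m) : M.map (.ofEquiv σ.symm) (M.map (.ofEquiv σ) x) = x := by
  have : (Surj.ofEquiv σ).comp (Surj.ofEquiv σ.symm) = .id m :=
    Subtype.ext (funext fun i => by simp [Surj.comp, Surj.ofEquiv, Surj.id])
  rw [hM.map_comp, this, hM.map_id]

/-- The homomorphism `[x, q] ↦ q(x)` from the disjoint union of the canonical liftings. -/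
def fromLiftings (hM : M.IsPresheaf) :
    disjointUnion (fun m : ℕ+ => canonicalLifting (M.faithfulAction hM m)) ⟶ M :=
  Hom.mk
    (fun n p => Quot.lift (fun r : M.FaithfulPart p.1 × Surj n p.1 => M.map r.2 r.1.1)
      (by
        rintro ⟨x₁, q₁⟩ ⟨x₂, q₂⟩ ⟨σ, h, h'⟩
        dsimp only at h h' ⊢
        rw [← h, ← h', ← hM.map_comp]
        rfl) p.2)
    (by
      rintro m n f ⟨k, p⟩
      induction p using Quot.ind with
      | mk p => exact (hM.map_comp f p.2 p.1.1).symm)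

theorem fromLiftings_mk (hM : M.IsPresheaf) {n m : ℕ+} (x : M.FaithfulPart m) (q : Surj n m) :
    (fromLiftings hM).app n ⟨m, Quot.mk _ (x, q)⟩ = M.map q x.1 := rfl

/-- Surjectivity is generation. For injectivity, the bijection given by uniqueness equates the two
summands and is then a witness for the relation that defines the lifting. -/
theorem fromLiftings_bijective (hM : M.IsPresheaf) (hg : M.IsGenerated) (hu : M.HasUniqueness)
    (n : ℕ+) : Function.Bijective ((fromLiftings hM).app n) := by
  constructor
  · rintro ⟨m, p⟩ ⟨m', p'⟩ h
    induction p using Quot.ind with | mk p => ?_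
    induction p' using Quot.ind with | mk p' => ?_
    obtain ⟨x, q⟩ := p
    obtain ⟨x', q'⟩ := p'
    rw [fromLiftings_mk, fromLiftings_mk] at h
    obtain ⟨σ, hσ, hx⟩ := hu q' q x'.1 x.1 h.symm x'.2 x.2
    obtain rfl : m = m' := by simpa using (Fintype.card_congr σ).symm
    exact congrArg (Sigma.mk m) (Quot.sound ⟨σ, Subtype.ext hx, hσ⟩)
  · intro x
    obtain ⟨m, q, y, rfl, hy⟩ := hg n x
    exact ⟨⟨m, Quot.mk _ (⟨y, hy⟩, q)⟩, rfl⟩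

/-- Equality of classes in a canonical lifting. -/
theorem canonicalLifting_mk_eq_iff (hM : M.IsPresheaf) {n m : ℕ+}
    (p₁ p₂ : M.FaithfulPart m × Surj n m) :
    (Quot.mk _ p₁ : (canonicalLifting (M.faithfulAction hM m)).carrier n) = Quot.mk _ p₂ ↔
      ∃ σ : Equiv.Perm (Fin m), M.faithfulAction hM m σ p₁.1 = p₂.1 ∧
        (Surj.ofEquiv σ).comp p₂.2 = p₁.2 := by
  refine ⟨fun h => ?_, fun h => Quot.sound h⟩
  -- The defining relation is already an equivalence relation, since it comes from a group action;
  -- hence `Quot` identifies nothing more.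
  refine (Equivalence.quot_mk_eq_iff ⟨fun p => ?_, ?_, ?_⟩ _ _).1 h
  · exact ⟨1, Subtype.ext (hM.map_id m p.1.1), rfl⟩
  · rintro ⟨x, q⟩ ⟨x', q'⟩ ⟨σ, h, h'⟩
    dsimp only at h h'
    subst h h'
    refine ⟨σ.symm, Subtype.ext (hM.map_symm_map σ x.1), Subtype.ext (funext fun i => ?_)⟩
    simp [Surj.comp, Surj.ofEquiv]
  · rintro ⟨x, q⟩ ⟨x', q'⟩ ⟨x'', q''⟩ ⟨σ, h, h'⟩ ⟨τ, k, k'⟩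
    dsimp only at h h' k k'
    subst h h' k k'
    exact ⟨σ * τ, Subtype.ext (hM.map_comp (.ofEquiv τ) (.ofEquiv σ) x.1).symm, rfl⟩

theorem models_T₂_iff_isUnionOfLiftings :
    M.Models T₂ ↔ ∃ hM : M.IsPresheaf, M.IsUnionOfLiftings hM := by
  rw [models_T₂]
  constructor
  · rintro ⟨hM, hg, hu⟩
    exact ⟨hM, isoOfBijective (fromLiftings hM) (fromLiftings_bijective hM hg hu),
      fun m x => hM.map_id m x.1⟩
  · rintro ⟨hM, e, he⟩
    -- As `[x, q] = q([x, 1])`, the condition on `e` determines it everywhere.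
    have key : ∀ {n m : ℕ+} (x : M.FaithfulPart m) (q : Surj n m),
        e.hom.app n ⟨m, Quot.mk _ (x, q)⟩ = M.map q x.1 := fun x q =>
      (e.hom.comm q _).trans (congrArg (M.map q) (he _ x))
    refine ⟨hM, fun n x => ?_, fun {k n m} f g x y h hx hy => ?_⟩
    · obtain ⟨⟨m, p⟩, rfl⟩ := (bijective_of_iso e n).2 x
      induction p using Quot.ind with
      | mk p => exact ⟨m, p.2, p.1.1, (key p.1 p.2).symm, p.1.2⟩
    · have h' := (bijective_of_iso e k).1
        (((key ⟨x, hx⟩ f).trans h).trans (key ⟨y, hy⟩ g).symm)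
      obtain rfl : n = m := congrArg Sigma.fst h'
      obtain ⟨σ, hσ, hσ'⟩ := (canonicalLifting_mk_eq_iff hM _ _).1 (eq_of_heq (Sigma.mk.inj h').2)
      dsimp only at hσ hσ'
      refine ⟨σ.symm, ?_, ?_⟩
      · rw [← hσ']
        exact Subtype.ext (funext fun i => by simp [Surj.comp, Surj.ofEquiv])
      · exact (congrArg _ (congrArg Subtype.val hσ).symm).trans (hM.map_symm_map σ x)

end LStr

/-! ### Finite limits of finite S5-algebras -/

namespace FinS5Alg

open Limits

variable {A B C : FinS5Alg.{v}}

@[ext]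
theorem hom_ext {f g : A ⟶ B} (h : ∀ a, f.toBoolHom a = g.toBoolHom a) : f = g :=
  Hom.ext (DFunLike.ext _ _ h)

@[simp] theorem id_toBoolHom (a : A.carrier) : Hom.toBoolHom (𝟙 A) a = a := rfl

@[simp] theorem comp_toBoolHom (f : A ⟶ B) (g : B ⟶ C) (a : A.carrier) :
    (f ≫ g).toBoolHom a = g.toBoolHom (f.toBoolHom a) := rfl

/-- The one-element S5-algebra. -/
def unit : FinS5Alg.{v} :=
  @FinS5Alg.mk PUnit.{v + 1}
    { box := _root_.id
      box_top := rfl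
      box_inf := fun _ _ => rfl
      box_le := fun _ => le_rfl
      box_le_box_box := fun _ => le_rfl
      compl_box_le := fun _ => le_rfl } inferInstance

instance : Unique unit.{v}.carrier := inferInstanceAs (Unique PUnit)

/-- The one-element S5-algebra is terminal. -/
def isTerminalUnit : IsTerminal unit.{v} :=
  IsTerminal.ofUniqueHom
    (fun _ => Hom.mk
      { toFun := fun _ => default
        map_sup' := fun _ _ => rfl
        map_inf' := fun _ _ => rfl
        map_top' := rfl
        map_bot' := rfl } fun _ => rfl)
    fun _ _ => hom_ext fun _ => Subsingleton.elim _ _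

/-- The subalgebra of the product on which two homomorphisms agree. -/
def pullbackSubalgebra (f : A ⟶ C) (g : B ⟶ C) : BooleanSubalgebra (A.carrier × B.carrier) where
  carrier := {p | f.toBoolHom p.1 = g.toBoolHom p.2}
  supClosed' p hp q hq := by simp_all
  infClosed' p hp q hq := by simp_all
  compl_mem' {p} hp := by simp_all
  bot_mem' := by simp

theorem mem_pullbackSubalgebra {f : A ⟶ C} {g : B ⟶ C} {p : A.carrier × B.carrier} :
    p ∈ pullbackSubalgebra f g ↔ f.toBoolHom p.1 = g.toBoolHom p.2 := Iff.rfl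

/-- The pullback of finite S5-algebras. -/
def pullbackObj (f : A ⟶ C) (g : B ⟶ C) : FinS5Alg.{v} :=
  @FinS5Alg.mk (pullbackSubalgebra f g)
    { box := fun p => ⟨(S5Algebra.box p.1.1, S5Algebra.box p.1.2), by
        rw [mem_pullbackSubalgebra, f.map_box, g.map_box, mem_pullbackSubalgebra.1 p.2]⟩
      box_top := Subtype.ext (Prod.ext S5Algebra.box_top S5Algebra.box_top)
      box_inf := fun _ _ => Subtype.ext (Prod.ext (S5Algebra.box_inf _ _) (S5Algebra.box_inf _ _))
      box_le := fun _ => ⟨S5Algebra.box_le _, S5Algebra.box_le _⟩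
      box_le_box_box := fun _ => ⟨S5Algebra.box_le_box_box _, S5Algebra.box_le_box_box _⟩
      compl_box_le := fun _ => ⟨S5Algebra.compl_box_le _, S5Algebra.compl_box_le _⟩ }
    inferInstance

/-- The first projection of the pullback. -/
def pullbackFst (f : A ⟶ C) (g : B ⟶ C) : pullbackObj f g ⟶ A :=
  @Hom.mk (pullbackObj f g) A
    { toFun := fun p : pullbackSubalgebra f g => p.1.1
      map_sup' := fun _ _ => rfl
      map_inf' := fun _ _ => rfl
      map_top' := rfl
      map_bot' := rfl } fun _ => rfl

/-- The second projection of the pullback. -/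
def pullbackSnd (f : A ⟶ C) (g : B ⟶ C) : pullbackObj f g ⟶ B :=
  @Hom.mk (pullbackObj f g) B
    { toFun := fun p : pullbackSubalgebra f g => p.1.2
      map_sup' := fun _ _ => rfl
      map_inf' := fun _ _ => rfl
      map_top' := rfl
      map_bot' := rfl } fun _ => rfl

theorem pullback_ext {f : A ⟶ C} {g : B ⟶ C} {p q : (pullbackObj f g).carrier}
    (h₁ : (pullbackFst f g).toBoolHom p = (pullbackFst f g).toBoolHom q)
    (h₂ : (pullbackSnd f g).toBoolHom p = (pullbackSnd f g).toBoolHom q) : p = q :=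
  Subtype.ext (Prod.ext h₁ h₂)

theorem exists_of_pullback {f : A ⟶ C} {g : B ⟶ C} (a : A.carrier) (b : B.carrier)
    (h : f.toBoolHom a = g.toBoolHom b) :
    ∃ p, (pullbackFst f g).toBoolHom p = a ∧ (pullbackSnd f g).toBoolHom p = b :=
  ⟨(⟨(a, b), h⟩ : pullbackSubalgebra f g), rfl, rfl⟩

theorem isPullback_pullbackObj (f : A ⟶ C) (g : B ⟶ C) :
    IsPullback (pullbackFst f g) (pullbackSnd f g) f g where
  w := hom_ext fun p => mem_pullbackSubalgebra.1 (Subtype.property p)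
  isLimit' := ⟨PullbackCone.IsLimit.mk _
    (fun s => @Hom.mk s.pt (pullbackObj f g)
      { toFun := fun d => (⟨(s.fst.toBoolHom d, s.snd.toBoolHom d),
          congrArg (fun k : s.pt ⟶ C => k.toBoolHom d) s.condition⟩ : pullbackSubalgebra f g)
        map_sup' := fun _ _ => Subtype.ext (Prod.ext (map_sup _ _ _) (map_sup _ _ _))
        map_inf' := fun _ _ => Subtype.ext (Prod.ext (map_inf _ _ _) (map_inf _ _ _))
        map_top' := Subtype.ext (Prod.ext (map_top _) (map_top _))
        map_bot' := Subtype.ext (Prod.ext (map_bot _) (map_bot _)) }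
      fun d => Subtype.ext (Prod.ext (s.fst.map_box d) (s.snd.map_box d)))
    (fun _ => rfl) (fun _ => rfl)
    fun _ _ h₁ h₂ => hom_ext fun d => pullback_ext
      (congrArg (fun k : _ ⟶ A => k.toBoolHom d) h₁)
      (congrArg (fun k : _ ⟶ B => k.toBoolHom d) h₂)⟩

instance : HasTerminal FinS5Alg.{v} := isTerminalUnit.hasTerminal

instance : HasPullbacks FinS5Alg.{v} :=
  have (A B C : FinS5Alg.{v}) (f : A ⟶ C) (g : B ⟶ C) : HasLimit (cospan f g) :=
    (isPullback_pullbackObj f g).hasPullback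
  hasPullbacks_of_hasLimit_cospan _

instance : HasFiniteLimits FinS5Alg.{v} := hasFiniteLimits_of_hasTerminal_and_pullbacks

end FinS5Alg

/-! ### Homomorphisms to powerset algebras -/

/-- Membership in an element of a powerset algebra. -/
def PowMem {n : ℕ+} (i : Fin n) (a : (powAlg.{v} n).carrier) : Prop :=
  Membership.mem (γ := Set (ULift.{v} (Fin n))) a (ULift.up i)

namespace PowMem

variable {n m : ℕ+}

theorem ext {a b : (powAlg.{v} n).carrier} (h : ∀ i, PowMem i a ↔ PowMem i b) : a = b :=
  Set.ext fun i => h i.down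

theorem top (i : Fin n) : PowMem.{v} i ⊤ := trivial

theorem not_bot (i : Fin n) : ¬ PowMem.{v} i ⊥ := fun h => h

theorem inf_iff {i : Fin n} {a b : (powAlg.{v} n).carrier} :
    PowMem i (a ⊓ b) ↔ PowMem i a ∧ PowMem i b := Iff.rfl

theorem sup_iff {i : Fin n} {a b : (powAlg.{v} n).carrier} :
    PowMem i (a ⊔ b) ↔ PowMem i a ∨ PowMem i b := Iff.rfl

theorem compl_iff {i : Fin n} {a : (powAlg.{v} n).carrier} :
    PowMem i aᶜ ↔ ¬ PowMem i a := Iff.rfl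

theorem box_iff {i : Fin n} {a : (powAlg.{v} n).carrier} :
    PowMem i (S5Algebra.box a) ↔ ∀ j, PowMem j a := by
  classical
  change ULift.up i ∈ (if @Eq (Set (ULift.{v} (Fin n))) a Set.univ then Set.univ else ∅) ↔ _
  constructor
  · intro h j
    split_ifs at h with h'
    · exact Set.eq_univ_iff_forall.1 h' _
    · exact h.elim
  · intro h
    have hu : @Eq (Set (ULift.{v} (Fin n))) a Set.univ :=
      Set.eq_univ_of_forall (α := ULift.{v} (Fin n)) fun j => h j.down
    rw [if_pos hu]
    trivial

theorem preimageHom_iff (f : Surj m n) {i : Fin m} {a : (powAlg.{v} n).carrier} :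
    PowMem i ((preimageHom f).toBoolHom a) ↔ PowMem (f.1 i) a := Iff.rfl

/-- The element of the powerset algebra given by a predicate. -/
def mk (p : Fin n → Prop) : (powAlg.{v} n).carrier :=
  (show Set (ULift.{v} (Fin n)) from {i | p i.down})

theorem mk_iff {p : Fin n → Prop} {i : Fin n} : PowMem.{v} i (mk p) ↔ p i := Iff.rfl

theorem finset_sup_iff {ι : Type*} (s : Finset ι) (h : ι → (powAlg.{v} n).carrier) (i : Fin n) :
    PowMem i (s.sup h) ↔ ∃ w ∈ s, PowMem i (h w) := by
  classical
  induction s using Finset.induction with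
  | empty => simpa using not_bot i
  | insert a s _ ih => simp [sup_iff, ih]

end PowMem

/-- A homomorphism to a powerset algebra, from its membership relation. -/
def toPow {A : FinS5Alg.{v}} {n : ℕ+} (r : Fin n → A.carrier → Prop) (htop : ∀ i, r i ⊤)
    (hbot : ∀ i, ¬ r i ⊥) (hinf : ∀ i a b, r i (a ⊓ b) ↔ r i a ∧ r i b)
    (hsup : ∀ i a b, r i (a ⊔ b) ↔ r i a ∨ r i b)
    (hbox : ∀ i a, r i (S5Algebra.box a) ↔ ∀ j, r j a) : A ⟶ powAlg.{v} n :=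
  FinS5Alg.Hom.mk
    { toFun := fun a => PowMem.mk fun i => r i a
      map_sup' := fun a b => PowMem.ext fun i => by
        rw [PowMem.sup_iff]; exact hsup i a b
      map_inf' := fun a b => PowMem.ext fun i => by
        rw [PowMem.inf_iff]; exact hinf i a b
      map_top' := PowMem.ext fun i => iff_of_true (htop i) (PowMem.top i)
      map_bot' := PowMem.ext fun i => iff_of_false (hbot i) (PowMem.not_bot i) }
    fun a => PowMem.ext fun i => by
      rw [PowMem.box_iff]; exact hbox i a

theorem powMem_toPow {A : FinS5Alg.{v}} {n : ℕ+} (r : Fin n → A.carrier → Prop) (htop hbot hinf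
    hsup hbox) (i : Fin n) (a : A.carrier) :
    PowMem i ((toPow r htop hbot hinf hsup hbox).toBoolHom a) ↔ r i a := Iff.rfl

theorem pow_hom_ext {A : FinS5Alg.{v}} {n : ℕ+} {h k : A ⟶ powAlg.{v} n}
    (H : ∀ i a, PowMem i (h.toBoolHom a) ↔ PowMem i (k.toBoolHom a)) : h = k :=
  FinS5Alg.hom_ext fun a => PowMem.ext fun i => H i a

theorem preimageHom_comp {r m n : ℕ+} (f : Surj r m) (g : Surj m n) :
    preimageHom.{v} (g.comp f) = preimageHom g ≫ preimageHom f := rfl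

/-- Every point of the target of `q` is some `q j`, so membership there can be tested at `j` after
taking preimages. -/
instance {m n : ℕ+} (q : Surj m n) : Mono (preimageHom.{v} q) where
  right_cancellation h k H := pow_hom_ext fun i a => by
    obtain ⟨j, rfl⟩ := q.2 i
    rw [← PowMem.preimageHom_iff, ← PowMem.preimageHom_iff, ← FinS5Alg.comp_toBoolHom,
      ← FinS5Alg.comp_toBoolHom, H]

/-- A homomorphism to a powerset algebra with values that are saturated for a surjection factors
through the preimage map. -/
theorem exists_factor_preimageHom {A : FinS5Alg.{v}} {m n : ℕ+} (q : Surj m n)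
    (h : A ⟶ powAlg.{v} m)
    (H : ∀ a i j, q.1 i = q.1 j → PowMem i (h.toBoolHom a) → PowMem j (h.toBoolHom a)) :
    ∃ k : A ⟶ powAlg.{v} n, k ≫ preimageHom q = h := by
  have hs : ∀ i, q.1 (Function.surjInv q.2 i) = i := Function.surjInv_eq q.2
  -- Membership is tested at a chosen preimage; by saturation the choice does not matter.
  refine ⟨toPow (fun i a => PowMem (Function.surjInv q.2 i) (h.toBoolHom a)) ?_ ?_ ?_ ?_ ?_, ?_⟩
  · intro i
    rw [map_top]
    exact PowMem.top _
  · intro i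
    rw [map_bot]
    exact PowMem.not_bot _
  · intro i a b
    rw [map_inf, PowMem.inf_iff]
  · intro i a b
    rw [map_sup, PowMem.sup_iff]
  · intro i a
    rw [h.map_box, PowMem.box_iff]
    exact ⟨fun H' j => H' _, fun H' j => H a _ _ (hs _) (H' (q.1 j))⟩
  · refine pow_hom_ext fun i a => ?_
    rw [FinS5Alg.comp_toBoolHom, PowMem.preimageHom_iff, powMem_toPow]
    exact ⟨H a _ _ (hs _), H a _ _ (hs _).symm⟩

/-! ### Decomposition of finite S5-algebras -/

section Atoms

variable {α : Type v} [BooleanAlgebra α]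

/-- Otherwise `a ⊓ bᶜ` is nonzero and has an atom below it. -/
theorem le_of_forall_atom_le [Finite α] {a b : α} (h : ∀ x, IsAtom x → x ≤ a → x ≤ b) :
    a ≤ b := by
  by_contra hab
  obtain h0 | ⟨x, hx, hxab⟩ := eq_bot_or_exists_atom_le (a ⊓ bᶜ)
  · exact hab (by simpa [disjoint_compl_right_iff] using disjoint_iff.2 h0)
  · exact (hx.not_le_iff_disjoint.2 (le_compl_iff_disjoint_right.1 (hxab.trans inf_le_right)))
      (h x hx (hxab.trans inf_le_left))

theorem _root_.IsAtom.le_finset_sup_iff {ι : Type*} {x : α} (hx : IsAtom x) (s : Finset ι)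
    (f : ι → α) : x ≤ s.sup f ↔ ∃ i ∈ s, x ≤ f i := by
  rw [← not_iff_not, hx.not_le_iff_disjoint, Finset.disjoint_sup_right]
  simp only [← hx.not_le_iff_disjoint, not_exists, not_and]

theorem _root_.IsAtom.le_compl_iff {x a : α} (hx : IsAtom x) : x ≤ aᶜ ↔ ¬ x ≤ a := by
  rw [hx.not_le_iff_disjoint, le_compl_iff_disjoint_right]

theorem _root_.IsAtom.le_sup_iff {x a b : α} (hx : IsAtom x) : x ≤ a ⊔ b ↔ x ≤ a ∨ x ≤ b := by
  rw [← not_iff_not, not_or, hx.not_le_iff_disjoint, disjoint_sup_right, hx.not_le_iff_disjoint,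
    hx.not_le_iff_disjoint]

/-- Ultrafilters of a finite Boolean algebra are principal. -/
theorem exists_atom_of_ultrafilter [Finite α] (p : α → Prop) (htop : p ⊤) (hbot : ¬ p ⊥)
    (hinf : ∀ a b, p (a ⊓ b) ↔ p a ∧ p b) (hsup : ∀ a b, p (a ⊔ b) ↔ p a ∨ p b) :
    ∃ x, IsAtom x ∧ ∀ a, p a ↔ x ≤ a := by
  classical
  have := Fintype.ofFinite α
  have hp : ∀ s : Finset α, (∀ a ∈ s, p a) → p (s.inf id) := by
    intro s
    induction s using Finset.induction with
    | empty => simpa using htop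
    | insert a s _ ih =>
      intro h
      rw [Finset.inf_insert, hinf]
      exact ⟨h a (by simp), ih fun b hb => h b (by simp [hb])⟩
  -- By finiteness the meet of all members is a member; it is the required atom.
  have hx : p ((Finset.univ.filter p).inf id) := hp _ (by simp)
  have hle : ∀ a, p a ↔ (Finset.univ.filter p).inf id ≤ a := fun a =>
    ⟨fun h => Finset.inf_le (f := id) (by simpa using h), fun h => by
      rw [← inf_eq_left.2 h, hinf] at hx
      exact hx.2⟩
  refine ⟨_, ⟨fun h => hbot (h ▸ hx), fun b hb => ?_⟩, hle⟩
  have h1 : ¬ p b := fun h => hb.not_ge ((hle b).1 h)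
  have h2 : p bᶜ := by
    have := (hsup b bᶜ).1 (by rwa [sup_compl_eq_top])
    tauto
  exact disjoint_self.1 (le_compl_iff_disjoint_right.1 (hb.le.trans ((hle _).1 h2)))

end Atoms

namespace S5Algebra

variable {A : Type v} [S5Algebra A]

theorem box_mono {a b : A} (h : a ≤ b) : box a ≤ box b := by
  rw [← inf_eq_left.2 h, box_inf]
  exact inf_le_right

/-- Two atoms are equivalent if they are below the same values of `□`. -/
def atomSetoid (A : Type v) [S5Algebra A] : Setoid {x : A // IsAtom x} where
  r x y := ∀ a : A, x.1 ≤ box a ↔ y.1 ≤ box a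
  iseqv := ⟨fun _ _ => Iff.rfl, fun h a => (h a).symm, fun h h' a => (h a).trans (h' a)⟩

/-- This is the Kripke semantics of S5, with equivalence of atoms as accessibility. For the hard
direction, let `d` be the meet of all `b` with `x ≤ □b`. Then `x ≤ □d`, and every atom below `□d` is
equivalent to `x`, so `□d ≤ a` and `x ≤ □d ≤ □□d ≤ □a`. -/
theorem le_box_iff [Finite A] (x : {x : A // IsAtom x}) (a : A) :
    x.1 ≤ box a ↔ ∀ y : {x : A // IsAtom x}, atomSetoid A x y → y.1 ≤ a := by
  classical
  refine ⟨fun h y hy => ((hy a).1 h).trans (box_le a), fun h => ?_⟩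
  have := Fintype.ofFinite A
  set s : Finset A := Finset.univ.filter fun b => x.1 ≤ box b with hs
  have hbox : ∀ t : Finset A, box (t.inf id) = t.inf box := by
    intro t
    induction t using Finset.induction with
    | empty => simpa using box_top
    | insert a t _ ih => rw [Finset.inf_insert, Finset.inf_insert, box_inf, ih]; rfl
  have hx : x.1 ≤ box (s.inf id) := by
    rw [hbox]
    exact Finset.le_inf fun b hb => by simpa [hs] using hb
  have hd : box (s.inf id) ≤ a := by
    refine le_of_forall_atom_le fun y hy hyd => h ⟨y, hy⟩ fun b => ⟨fun hb => ?_, fun hb => ?_⟩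
    · exact hyd.trans (box_mono (Finset.inf_le (f := id) (by simpa [hs] using hb)))
    -- Here the axiom `¬□b ≤ □¬□b` enters: if `x` is not below `□b`, then `¬□b` is one of the
    -- elements whose meet was taken, so `y` lies below `¬□b` as well as `□b`.
    · by_contra hxb
      have h1 : x.1 ≤ box (box b)ᶜ := (x.2.le_compl_iff.2 hxb).trans (compl_box_le b)
      have h2 : y ≤ (box b)ᶜ :=
        (hyd.trans (box_mono (Finset.inf_le (f := id) (by simpa [hs] using h1)))).trans (box_le _)
      exact hy.le_compl_iff.1 h2 hb
  exact hx.trans ((box_le_box_box _).trans (box_mono hd))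

end S5Algebra

/-- An enumeration of the equivalence classes of atoms of a finite S5-algebra. -/
structure AtomClasses (A : FinS5Alg.{v}) where
  /-- The number of classes. -/
  card : ℕ
  /-- The size of each class. -/
  size : Fin card → ℕ+
  /-- The atoms of each class. -/
  atom : ∀ c, Fin (size c) → A.carrier
  isAtom : ∀ c i, IsAtom (atom c i)
  surj : ∀ x, IsAtom x → ∃ c i, x = atom c i
  inj : ∀ {c c' i i'}, atom c i = atom c' i' → (⟨c, i⟩ : Σ c, Fin (size c)) = ⟨c', i'⟩
  le_box_iff : ∀ c i a, atom c i ≤ S5Algebra.box a ↔ ∀ j, atom c j ≤ a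
  eq_of_le_box_iff : ∀ c i c' i',
    (∀ a, atom c i ≤ S5Algebra.box a ↔ atom c' i' ≤ S5Algebra.box a) → c = c'

theorem nonempty_atomClasses (A : FinS5Alg.{v}) : Nonempty (AtomClasses A) := by
  classical
  let s := S5Algebra.atomSetoid A.carrier
  let e : Quotient s ≃ Fin _ := Finite.equivFin _
  let cls (c) : Type v := {x : {x : A.carrier // IsAtom x} // (Quotient.mk s x) = e.symm c}
  have hne (c) : Nonempty (cls c) := by
    obtain ⟨x, hx⟩ := Quotient.exists_rep (e.symm c)
    exact ⟨⟨x, hx⟩⟩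
  let k (c) : cls c ≃ Fin _ := Finite.equivFin _
  have hk (c) (i) : Quotient.mk s ((k c).symm i).1 = e.symm c := ((k c).symm i).2
  refine ⟨{
    card := Nat.card (Quotient s)
    size := fun c => ⟨Nat.card (cls c), Nat.card_pos⟩
    atom := fun c i => ((k c).symm i).1.1
    isAtom := fun c i => ((k c).symm i).1.2
    surj := fun x hx => ⟨e (Quotient.mk s ⟨x, hx⟩), k _ ⟨⟨x, hx⟩, by simp⟩, by simp⟩
    inj := ?_
    le_box_iff := ?_
    eq_of_le_box_iff := ?_ }⟩
  · intro c c' i i' h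
    have h' : ((k c).symm i).1 = ((k c').symm i').1 := Subtype.ext h
    obtain rfl : c = c' := by
      rw [← e.symm.injective.eq_iff, ← hk c i, ← hk c' i', h']
    rw [(k c).symm.injective (Subtype.ext h')]
  · intro c i a
    rw [S5Algebra.le_box_iff]
    constructor
    · intro h j
      exact h _ (Quotient.exact ((hk c i).trans (hk c j).symm))
    · intro h y hy
      have h1 : Quotient.mk s y = e.symm c := (Quotient.sound hy).symm.trans (hk c i)
      simpa using h (k c ⟨y, h1⟩)
  · intro c i c' i' h
    have h1 : Quotient.mk s ((k c).symm i).1 = Quotient.mk s ((k c').symm i').1 := Quotient.sound h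
    exact e.symm.injective ((hk c i).symm.trans (h1.trans (hk c' i')))

namespace AtomClasses

open Limits

variable {A : FinS5Alg.{v}} (d : AtomClasses A)

/-- The projection to the powerset algebra of a class. -/
noncomputable def proj (c : Fin d.card) : A ⟶ powAlg.{v} (d.size c) :=
  toPow (fun i a => d.atom c i ≤ a) (fun _ => le_top) (fun i h => (d.isAtom c i).1 (le_bot_iff.1 h))
    (fun _ _ _ => le_inf_iff) (fun i _ _ => (d.isAtom c i).le_sup_iff) (d.le_box_iff c)

theorem le_of_forall {a b : A.carrier} (h : ∀ c i, d.atom c i ≤ a → d.atom c i ≤ b) : a ≤ b :=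
  le_of_forall_atom_le fun x hx => by
    obtain ⟨c, i, rfl⟩ := d.surj x hx
    exact h c i

theorem ext_of_forall {a b : A.carrier} (h : ∀ c i, d.atom c i ≤ a ↔ d.atom c i ≤ b) : a = b :=
  le_antisymm (d.le_of_forall fun c i => (h c i).1) (d.le_of_forall fun c i => (h c i).2)

/-- The join of the selected atoms works, as distinct atoms are incomparable. This is what allows
maps into the product to be lifted to `A`. -/
theorem exists_forall_atom_le_iff (p : ∀ c, Fin (d.size c) → Prop) :
    ∃ a, ∀ c i, d.atom c i ≤ a ↔ p c i := by
  classical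
  refine ⟨(Finset.univ.filter fun x : Σ c, Fin (d.size c) => p x.1 x.2).sup
    fun x => d.atom x.1 x.2, fun c i => ?_⟩
  rw [(d.isAtom c i).le_finset_sup_iff]
  constructor
  · rintro ⟨⟨c', i'⟩, h, h'⟩
    have := d.inj (((d.isAtom c' i').le_iff.1 h').resolve_left (d.isAtom c i).1)
    cases this
    simpa using h
  · intro h
    exact ⟨⟨c, i⟩, by simpa using h, le_rfl⟩

/-- A finite S5-algebra is the product of the powerset algebras of its classes of atoms. -/
noncomputable def isLimitFan : IsLimit (Fan.mk A d.proj) := by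
  choose g hg using d.exists_forall_atom_le_iff
  refine Fan.IsLimit.mk _ (fun s => FinS5Alg.Hom.mk
    { toFun := fun b => g fun c i => PowMem i ((s.proj c).toBoolHom b)
      map_sup' := fun a b => d.ext_of_forall fun c i => by
        rw [(d.isAtom c i).le_sup_iff, hg, hg, hg, map_sup, PowMem.sup_iff]
      map_inf' := fun a b => d.ext_of_forall fun c i => by
        rw [le_inf_iff, hg, hg, hg, map_inf, PowMem.inf_iff]
      map_top' := d.ext_of_forall fun c i => by
        rw [hg, map_top]
        exact iff_of_true (PowMem.top i) le_top
      map_bot' := d.ext_of_forall fun c i => by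
        rw [hg, map_bot]
        exact iff_of_false (PowMem.not_bot i) fun h => (d.isAtom c i).1 (le_bot_iff.1 h) }
    fun b => d.ext_of_forall fun c i => by
      change d.atom c i ≤ g _ ↔ d.atom c i ≤ S5Algebra.box (g _)
      rw [d.le_box_iff, hg, (s.proj c).map_box, PowMem.box_iff]
      exact forall_congr' fun j =>
        (hg (fun c i => PowMem i ((s.proj c).toBoolHom b)) c j).symm) ?_ ?_
  · intro s c
    exact pow_hom_ext fun i b => hg _ c i
  · intro s m hm
    refine FinS5Alg.hom_ext fun b => d.ext_of_forall fun c i => ?_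
    refine Iff.trans ?_ (hg _ c i).symm
    rw [← hm c]
    rfl

/-- A homomorphism to a powerset algebra factors through the projection to a class. -/
theorem exists_factor {n : ℕ+} (k : A ⟶ powAlg.{v} n) :
    ∃ (c : Fin d.card) (f : Surj n (d.size c)), k = d.proj c ≫ preimageHom f := by
  have h : ∀ i : Fin n, ∃ c j, ∀ a, PowMem i (k.toBoolHom a) ↔ d.atom c j ≤ a := by
    intro i
    -- A point of `n` pulls back along `k` to an ultrafilter, that is, to an atom of `A`.
    obtain ⟨x, hx, h⟩ := exists_atom_of_ultrafilter (fun a => PowMem i (k.toBoolHom a))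
      (by rw [map_top]; exact PowMem.top i) (by rw [map_bot]; exact PowMem.not_bot i)
      (fun a b => by rw [map_inf, PowMem.inf_iff]) (fun a b => by rw [map_sup, PowMem.sup_iff])
    obtain ⟨c, j, rfl⟩ := d.surj x hx
    exact ⟨c, j, h⟩
  choose c f hf using h
  -- Membership in a value of `□` on `P(n)` does not depend on the point, so all the atoms found are
  -- equivalent.
  have hc : ∀ i i', c i = c i' := fun i i' => d.eq_of_le_box_iff _ (f i) _ (f i') fun a => by
    rw [← hf, ← hf, k.map_box, PowMem.box_iff, PowMem.box_iff]
  obtain ⟨c₀, hc₀⟩ : ∃ c₀, ∀ i, c i = c₀ := ⟨c ⟨0, n.pos⟩, fun i => hc _ _⟩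
  obtain rfl : c = fun _ => c₀ := funext hc₀
  refine ⟨c₀, ⟨f, fun j => ?_⟩, pow_hom_ext fun i a => hf i a⟩
  -- If the atom at `j` were missed, `k` would send its complement to the top, hence also the `□` of
  -- the complement; then every atom of the class, including the one at `j`, would be below that
  -- complement.
  by_contra hj
  have h1 : ∀ i, PowMem i (k.toBoolHom (d.atom c₀ j)ᶜ) := fun i => by
    rw [hf, (d.isAtom _ _).le_compl_iff]
    intro h
    have := d.inj (((d.isAtom c₀ j).le_iff.1 h).resolve_left (d.isAtom _ _).1)
    exact hj ⟨i, by simpa using this⟩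
  have h2 := PowMem.box_iff (i := (⟨0, n.pos⟩ : Fin n)).2 h1
  rw [← k.map_box, hf, d.le_box_iff] at h2
  exact (d.isAtom c₀ j).le_compl_iff.1 (h2 j) le_rfl

end AtomClasses

/-! ### Pullbacks and equalizers of preimage maps -/

theorem Surj.exists_of_setoid {n : ℕ+} (s : Setoid (Fin n)) :
    ∃ (p : ℕ+) (q : Surj n p), ∀ i j, q.1 i = q.1 j ↔ s i j := by
  have : Nonempty (Quotient s) := ⟨Quotient.mk s ⟨0, n.pos⟩⟩
  let e : Quotient s ≃ Fin _ := Finite.equivFin _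
  refine ⟨⟨Nat.card (Quotient s), Nat.card_pos⟩,
    ⟨fun i => e (Quotient.mk s i), e.surjective.comp Quotient.mk_surjective⟩, fun i j => ?_⟩
  exact e.injective.eq_iff.trans Quotient.eq

theorem Surj.exists_factor {k n p : ℕ+} (f : Surj k n) (q : Surj k p)
    (h : ∀ i j, f.1 i = f.1 j → q.1 i = q.1 j) : ∃ a : Surj n p, a.comp f = q := by
  have key : ∀ i, q.1 (Function.surjInv f.2 (f.1 i)) = q.1 i := fun i =>
    h _ _ (Function.surjInv_eq f.2 _)
  refine ⟨⟨fun i => q.1 (Function.surjInv f.2 i), fun i => ?_⟩, Subtype.ext (funext key)⟩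
  obtain ⟨j, rfl⟩ := q.2 i
  exact ⟨f.1 j, key j⟩

/-- Two points are equivalent if both or neither belong to `a`. -/
def memSetoid {n : ℕ+} (a : (powAlg.{v} n).carrier) : Setoid (Fin n) where
  r i j := PowMem i a ↔ PowMem j a
  iseqv := ⟨fun _ => Iff.rfl, fun h => h.symm, fun h h' => h.trans h'⟩

/-- The preimage maps of two surjections have a pullback that is given by their pushout. -/
theorem exists_isPullback_preimageHom {k n m : ℕ+} (f : Surj k n) (g : Surj k m) :
    ∃ (p : ℕ+) (a : Surj n p) (b : Surj m p), a.comp f = b.comp g ∧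
      IsPullback (preimageHom.{v} a) (preimageHom b) (preimageHom f) (preimageHom g) := by
  -- The pushout of `f` and `g` is the quotient of their common source by the join of the kernels.
  obtain ⟨p, q, hq⟩ := Surj.exists_of_setoid (Setoid.ker f.1 ⊔ Setoid.ker g.1)
  obtain ⟨a, ha⟩ := f.exists_factor q fun i j h =>
    (hq i j).2 ((le_sup_left : Setoid.ker f.1 ≤ Setoid.ker f.1 ⊔ Setoid.ker g.1) h)
  obtain ⟨b, hb⟩ := g.exists_factor q fun i j h =>
    (hq i j).2 ((le_sup_right : Setoid.ker g.1 ≤ Setoid.ker f.1 ⊔ Setoid.ker g.1) h)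
  have hw : preimageHom.{v} a ≫ preimageHom f = preimageHom b ≫ preimageHom g := by
    rw [← preimageHom_comp, ← preimageHom_comp, ha, hb]
  have hlift : ∀ s : Limits.PullbackCone (preimageHom.{v} f) (preimageHom g),
      ∃ l : s.pt ⟶ powAlg p, l ≫ preimageHom a = s.fst ∧ l ≫ preimageHom b = s.snd := by
    intro s
    -- The common composite of the cone has values saturated for both kernels, hence for their join.
    obtain ⟨l, hl⟩ := exists_factor_preimageHom q (s.fst ≫ preimageHom f) fun d i j hij => by
      have hle : Setoid.ker f.1 ⊔ Setoid.ker g.1 ≤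
          memSetoid ((s.fst ≫ preimageHom f).toBoolHom d) := by
        refine sup_le ?_ ?_
        · intro i j h
          change PowMem _ _ ↔ PowMem _ _
          rw [FinS5Alg.comp_toBoolHom, PowMem.preimageHom_iff, PowMem.preimageHom_iff,
            Setoid.ker_def.1 h]
        · intro i j h
          change PowMem _ _ ↔ PowMem _ _
          rw [s.condition, FinS5Alg.comp_toBoolHom, PowMem.preimageHom_iff,
            PowMem.preimageHom_iff, Setoid.ker_def.1 h]
      exact (hle ((hq i j).1 hij)).1
    refine ⟨l, ?_, ?_⟩
    · rw [← cancel_mono (preimageHom f), Category.assoc, ← preimageHom_comp, ha, hl]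
    · rw [← cancel_mono (preimageHom g), Category.assoc, ← preimageHom_comp, hb, hl, s.condition]
  choose l hl hl' using hlift
  exact ⟨p, a, b, ha.trans hb.symm, ⟨hw⟩, ⟨Limits.PullbackCone.IsLimit.mk _ l hl hl'
    fun s m h _ => by rw [← cancel_mono (preimageHom a), h, hl]⟩⟩

/-- The equalizer of the preimage map of a permutation and the identity. -/
theorem exists_isLimit_fork_preimageHom {n : ℕ+} (σ : Equiv.Perm (Fin n)) (hσ : σ ≠ 1) :
    ∃ (p : ℕ+) (q : Surj n p) (w : preimageHom.{v} q ≫ preimageHom (.ofEquiv σ) =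
      preimageHom q ≫ 𝟙 _), p < n ∧ Nonempty (Limits.IsLimit (Limits.Fork.ofι _ w)) := by
  -- The quotient by the orbits of `σ`.
  obtain ⟨p, q, hq⟩ := Surj.exists_of_setoid (Relation.EqvGen.setoid fun i j => σ i = j)
  have hqσ : ∀ i, q.1 (σ i) = q.1 i := fun i => ((hq _ _).2 (.rel _ _ rfl)).symm
  have hcomp : q.comp (.ofEquiv σ) = q := Subtype.ext (funext hqσ)
  have w : preimageHom.{v} q ≫ preimageHom (.ofEquiv σ) = preimageHom q ≫ 𝟙 _ := by
    rw [← preimageHom_comp, hcomp, Category.comp_id]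
  refine ⟨p, q, w, lt_of_le_of_ne q.le ?_, ⟨?_⟩⟩
  -- With as many orbits as points, `q` would be injective, and `q ∘ σ = q` would give `σ = 1`.
  · rintro rfl
    exact hσ (Equiv.ext fun i => Finite.injective_iff_surjective.2 q.2 (hqσ i))
  · have hlift : ∀ s : Limits.Fork (preimageHom.{v} (.ofEquiv σ)) (𝟙 (powAlg n)),
        ∃ l : s.pt ⟶ powAlg p, l ≫ preimageHom q = s.ι := by
      intro s
      refine exists_factor_preimageHom q s.ι fun d i j hij => ?_
      have hle : Relation.EqvGen.setoid (fun i j => σ i = j) ≤ memSetoid (s.ι.toBoolHom d) := by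
        refine Setoid.eqvGen_le ?_
        rintro i _ rfl
        have h := congrArg (fun k : s.pt ⟶ powAlg n => k.toBoolHom d) s.condition
        simp only [Category.comp_id] at h
        change PowMem i (s.ι.toBoolHom d) ↔
          PowMem i ((s.ι ≫ preimageHom (.ofEquiv σ)).toBoolHom d)
        rw [h]
      exact (hle ((hq i j).1 hij)).1
    choose l hl using hlift
    exact Limits.Fork.IsLimit.mk _ l hl fun s m h => by
      rw [← cancel_mono (preimageHom q), hl]
      exact h

/-! ### The structure given by a lex functor is a model -/

section Lex

open Limits

variable (G : FinS5Alg.{v} ⥤ Type u)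

theorem isPresheaf_restrict : (restrict.obj G).IsPresheaf where
  map_id n x := by
    exact G.map_id_apply _ x
  map_comp f g x := by
    exact (G.map_comp_apply (preimageHom g) (preimageHom f) x).symm

/-- An element fixed by some `σ ≠ 1` lies in the equalizer of the action of `σ` and the identity. As
`G` preserves this equalizer, the element comes from a strictly smaller sort, and induction applies.
-/
theorem isGenerated_restrict [PreservesFiniteLimits G] : (restrict.obj G).IsGenerated := by
  intro n
  induction n using PNat.strongInductionOn with
  | _ n ih =>
    intro x
    by_cases hx : (restrict.obj G).FixTrivial x
    · exact ⟨n, .id n, x, (isPresheaf_restrict G).map_id n x, hx⟩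
    · obtain ⟨σ, hσ, hσ1⟩ : ∃ σ : Equiv.Perm (Fin n),
          (restrict.obj G).map (.ofEquiv σ) x = x ∧ σ ≠ 1 := by
        simpa [LStr.FixTrivial] using hx
      obtain ⟨p, q, w, hp, ⟨hl⟩⟩ := exists_isLimit_fork_preimageHom.{v} σ hσ1
      obtain ⟨y, hy, -⟩ := Types.unique_of_type_equalizer _ _
        (isLimitForkMapOfIsLimit G w hl) x (hσ.trans (G.map_id_apply _ x).symm)
      obtain ⟨m, f, z, rfl, hz⟩ := ih p hp y
      exact ⟨m, f.comp q, z, ((isPresheaf_restrict G).map_comp q f z).symm.trans hy, hz⟩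

/-- If `a` identifies `i` and `j`, the transposition of `i` and `j` fixes the image of `z`. -/
theorem injective_of_fixTrivial {M : LStr.{u}} (hM : M.IsPresheaf) {n p : ℕ+} (a : Surj n p)
    (z : M.carrier p) (h : M.FixTrivial (M.map a z)) : Function.Injective a.1 := by
  intro i j hij
  have h1 : Equiv.swap i j = 1 := by
    refine h _ ?_
    rw [hM.map_comp]
    congr 1
    refine Subtype.ext (funext fun k => ?_)
    simp only [Surj.comp, Surj.ofEquiv, Function.comp_apply, Equiv.swap_apply_def]
    split_ifs with h1 h2
    · rw [h1, hij]
    · rw [h2, hij]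
    · rfl
  simpa using (Equiv.ext_iff.1 h1 i).symm

/-- Since `G` preserves the pullback of the two preimage maps, `x` and `y` are images of one `z`
along the pushout maps `a` and `b`. These are bijective because nothing but the identity fixes `x`
or `y`, and `b⁻¹ ∘ a` is the bijection. -/
theorem hasUniqueness_restrict [PreservesFiniteLimits G] : (restrict.obj G).HasUniqueness := by
  intro k n m f g x y h hx hy
  have hM := isPresheaf_restrict G
  obtain ⟨p, a, b, hab, hp⟩ := exists_isPullback_preimageHom.{v} f g
  obtain ⟨z, rfl, rfl⟩ := Types.exists_of_isPullback (hp.map G) x y h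
  have ha := injective_of_fixTrivial hM a z hx
  have hb := injective_of_fixTrivial hM b z hy
  let ea := Equiv.ofBijective a.1 ⟨ha, a.2⟩
  let eb := Equiv.ofBijective b.1 ⟨hb, b.2⟩
  have hba : b.comp (.ofEquiv (ea.trans eb.symm)) = a :=
    Subtype.ext (funext fun i => eb.apply_symm_apply (a.1 i))
  refine ⟨ea.trans eb.symm, Subtype.ext (funext fun i => ?_), ?_⟩
  · refine hb ?_
    refine (eb.apply_symm_apply (a.1 (f.1 i))).trans ?_
    exact congrFun (congrArg Subtype.val hab) i
  · refine (hM.map_comp (.ofEquiv (ea.trans eb.symm)) b z).trans ?_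
    rw [hba]
    rfl

theorem models_restrict [PreservesFiniteLimits G] : (restrict.obj G).Models T₂ :=
  LStr.models_T₂.2 ⟨isPresheaf_restrict G, isGenerated_restrict G, hasUniqueness_restrict G⟩

/-! ### Lex functors are determined by their restrictions -/

variable {A : FinS5Alg.{v}} (d : AtomClasses A)

/-- A lex functor takes the decomposition of a finite S5-algebra to a product. -/
noncomputable def isLimitFanMap [PreservesFiniteLimits G] :
    IsLimit (Fan.mk (G.obj A) fun c => G.map (d.proj c)) :=
  isLimitFanMkObjOfIsLimit G _ d.proj d.isLimitFan

variable {G} in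
theorem obj_ext [PreservesFiniteLimits G] {x y : G.obj A}
    (h : ∀ c, G.map (d.proj c) x = G.map (d.proj c) y) : x = y := by
  have : (↾fun _ : PUnit.{u + 1} => x) = ↾fun _ => y :=
    Fan.IsLimit.hom_ext (isLimitFanMap G d) _ _ fun c => by
      ext
      exact h c
  exact ConcreteCategory.congr_hom this .unit

theorem exists_obj [PreservesFiniteLimits G] (t : ∀ c, G.obj (powAlg (d.size c))) :
    ∃ x : G.obj A, ∀ c, G.map (d.proj c) x = t c :=
  ⟨(isLimitFanMap G d).lift (Fan.mk PUnit.{u + 1} fun c => ↾fun _ => t c) .unit,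
    fun c => ConcreteCategory.congr_hom ((isLimitFanMap G d).fac
      (Fan.mk PUnit.{u + 1} fun c => ↾fun _ => t c) ⟨c⟩) .unit⟩

variable {G} {G' : FinS5Alg.{v} ⥤ Type u}

/-- The component at `A` is assembled from `φ` on the factors of `A`. -/
theorem exists_map_restrict_eq [PreservesFiniteLimits G] [PreservesFiniteLimits G']
    (φ : restrict.obj G ⟶ restrict.obj G') :
    ∃ α : G ⟶ G', restrict.map α = φ := by
  have d (A : FinS5Alg.{v}) : AtomClasses A := (nonempty_atomClasses A).some
  choose α hα using fun (A : FinS5Alg.{v}) (x : G.obj A) =>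
    exists_obj G' (d A) fun c => φ.app _ (G.map ((d A).proj c) x)
  -- The defining equation extends from the projections to all homomorphisms `k` because `k` factors
  -- through a projection and `φ` commutes with preimage maps. Naturality and the value at `P(n)`
  -- (with `k` the identity) both follow.
  have key : ∀ {A : FinS5Alg.{v}} {n : ℕ+} (k : A ⟶ powAlg n) (x : G.obj A),
      G'.map k (α A x) = φ.app n (G.map k x) := by
    intro A n k x
    obtain ⟨c, f, rfl⟩ := (d A).exists_factor k
    rw [Functor.map_comp_apply, Functor.map_comp_apply, hα]
    exact (φ.comm f _).symm
  refine ⟨{ app := fun A => ↾(α A), naturality := fun A B k => ?_ }, ?_⟩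
  · ext x
    refine obj_ext (d B) fun c => ?_
    change G'.map _ (α B (G.map k x)) = G'.map _ (G'.map k (α A x))
    rw [key, ← Functor.map_comp_apply, ← Functor.map_comp_apply, key]
  · refine LStr.hom_ext fun n x => ?_
    have := key (𝟙 (powAlg n)) x
    exact (G'.map_id_apply _ _).symm.trans (this.trans (congrArg _ (G.map_id_apply _ x)))

theorem eq_of_map_restrict_eq [PreservesFiniteLimits G'] {α β : G ⟶ G'}
    (h : restrict.map α = restrict.map β) : α = β := by
  ext A x
  refine obj_ext (nonempty_atomClasses A).some fun c => ?_
  refine (NatTrans.naturality_apply α _ x).symm.trans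
    (Eq.trans ?_ (NatTrans.naturality_apply β _ x))
  exact congrArg (fun φ : restrict.obj G ⟶ restrict.obj G' => φ.app _ _) h

end Lex

/-! ### Sums of representable structures -/

namespace LStr

/-- The disjoint union of the structures represented by the sorts `m i`. -/
def sumRepresentables {I : Type u} (m : I → ℕ+) : LStr.{u} where
  carrier n := Σ i, Surj n (m i)
  map f p := ⟨p.1, p.2.comp f⟩

/-- The homomorphism from a sum of representable structures given by a family of elements. -/
def fromSumRepresentables {M : LStr.{u}} (hM : M.IsPresheaf) {I : Type u} {m : I → ℕ+}
    (x : ∀ i, M.carrier (m i)) : sumRepresentables m ⟶ M :=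
  Hom.mk (fun _ p => M.map p.2 (x p.1)) fun f p => (hM.map_comp f p.2 (x p.1)).symm

variable {M : LStr.{u}}

/-- Two elements that only the identity fixes are equivalent if they differ by a bijection. -/
def faithfulSetoid (hM : M.IsPresheaf) : Setoid (Σ m : ℕ+, M.FaithfulPart m) where
  r x y := ∃ σ : Fin x.1 ≃ Fin y.1, M.map (.ofEquiv σ) y.2.1 = x.2.1
  iseqv := by
    refine ⟨fun x => ⟨Equiv.refl _, hM.map_id _ _⟩, ?_, ?_⟩
    · rintro x y ⟨σ, hσ⟩
      exact ⟨σ.symm, by rw [← hσ, hM.map_symm_map]⟩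
    · rintro x y z ⟨σ, hσ⟩ ⟨τ, hτ⟩
      refine ⟨σ.trans τ, ?_⟩
      rw [← hσ, ← hτ, hM.map_comp]
      rfl

/-- An orbit of elements with trivial stabilizer has a representable lifting, freely generated by
any member; so one representative per class is taken. -/
theorem exists_iso_sumRepresentables (h : M.Models T₂) :
    ∃ (I : Type u) (m : I → ℕ+), Nonempty (sumRepresentables m ≅ M) := by
  obtain ⟨hM, hg, hu⟩ := models_T₂.1 h
  let s := faithfulSetoid hM
  refine ⟨Quotient s, fun i => i.out.1, ⟨isoOfBijective
    (fromSumRepresentables hM fun i => i.out.2.1) fun n => ⟨?_, fun y => ?_⟩⟩⟩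
  · rintro ⟨i, q⟩ ⟨i', q'⟩ hy
    obtain ⟨σ, hσ, hx⟩ := hu q q' i.out.2.1 i'.out.2.1 hy i.out.2.2 i'.out.2.2
    obtain rfl : i = i' := Quotient.out_equiv_out.1 ⟨σ, hx⟩
    -- Triviality of the stabilizer turns equality up to a permutation into `q = q'`.
    obtain rfl : σ = 1 := i.out.2.2 σ hx
    exact congrArg (Sigma.mk i) hσ
  · obtain ⟨m, q, x, rfl, hx⟩ := hg n y
    obtain ⟨σ, hσ⟩ := s.symm (Quotient.mk_out (s := s) ⟨m, x, hx⟩)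
    refine ⟨⟨Quotient.mk s ⟨m, x, hx⟩, (Surj.ofEquiv σ).comp q⟩, ?_⟩
    exact (hM.map_comp _ _ _).symm.trans (congrArg _ hσ)

end LStr

/-! ### The lex functor given by a sum of representable structures -/

section Labelling

open Limits

variable {I : Type u} {m : I → ℕ+}

/-- Partitions of unity of an S5-algebra with the labels `⟨i, j⟩`, `j < m i`, such that the
labels that occur in an equivalence class are those with a fixed `i`. -/
structure IsLabelling {A : FinS5Alg.{v}} (h : (Σ i, Fin (m i)) → A.carrier) : Prop where
  inf_eq_bot : ∀ w w', w ≠ w' → h w ⊓ h w' = ⊥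
  exists_sup_eq_top : ∃ s : Finset (Σ i, Fin (m i)), s.sup h = ⊤
  -- After complementing, the left side is the union of the classes in which `⟨i, j⟩` occurs, the
  -- right side the part labelled by `i`. So a class that meets this part lies in it and carries
  -- every `⟨i, j⟩`.
  box_compl : ∀ i j, S5Algebra.box (h ⟨i, j⟩)ᶜ = (Finset.univ.sup fun k => h ⟨i, k⟩)ᶜ

variable {A B C : FinS5Alg.{v}}

theorem IsLabelling.map {h : (Σ i, Fin (m i)) → A.carrier} (hh : IsLabelling h) (f : A ⟶ B) :
    IsLabelling fun w => f.toBoolHom (h w) where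
  inf_eq_bot w w' hw := by rw [← map_inf, hh.inf_eq_bot w w' hw, map_bot]
  exists_sup_eq_top := by
    obtain ⟨s, hs⟩ := hh.exists_sup_eq_top
    refine ⟨s, ?_⟩
    rw [← map_top f.toBoolHom, ← hs, map_finset_sup]
    rfl
  box_compl i j := by
    rw [← map_compl', ← f.map_box, hh.box_compl, map_compl', map_finset_sup]
    rfl

/-- Equations can be checked in both projections, and finite covers from the two sides have a finite
union. This makes labellings a lex functor even for infinite `I`. -/
theorem IsLabelling.of_pullback {f : A ⟶ C} {g : B ⟶ C}
    {h : (Σ i, Fin (m i)) → (FinS5Alg.pullbackObj f g).carrier}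
    (h₁ : IsLabelling fun w => (FinS5Alg.pullbackFst f g).toBoolHom (h w))
    (h₂ : IsLabelling fun w => (FinS5Alg.pullbackSnd f g).toBoolHom (h w)) : IsLabelling h where
  inf_eq_bot w w' hw := FinS5Alg.pullback_ext
    (by rw [map_inf, map_bot, h₁.inf_eq_bot w w' hw])
    (by rw [map_inf, map_bot, h₂.inf_eq_bot w w' hw])
  exists_sup_eq_top := by
    classical
    obtain ⟨s, hs⟩ := h₁.exists_sup_eq_top
    obtain ⟨t, ht⟩ := h₂.exists_sup_eq_top
    refine ⟨s ∪ t, FinS5Alg.pullback_ext ?_ ?_⟩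
    · rw [map_finset_sup, map_top, Finset.sup_union]
      exact eq_top_mono le_sup_left hs
    · rw [map_finset_sup, map_top, Finset.sup_union]
      exact eq_top_mono le_sup_right ht
  box_compl i j := FinS5Alg.pullback_ext
    (by
      rw [FinS5Alg.Hom.map_box, map_compl', map_compl', h₁.box_compl, map_finset_sup]
      rfl)
    (by
      rw [FinS5Alg.Hom.map_box, map_compl', map_compl', h₂.box_compl, map_finset_sup]
      rfl)

theorem IsLabelling.of_unit (h : (Σ i, Fin (m i)) → FinS5Alg.unit.{v}.carrier) :
    IsLabelling h where
  inf_eq_bot _ _ _ := Subsingleton.elim _ _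
  exists_sup_eq_top := ⟨∅, Subsingleton.elim _ _⟩
  box_compl _ _ := Subsingleton.elim _ _

variable (m) in
/-- The labellings of a finite S5-algebra, as a type in the universe of the labels. -/
def Labellings (A : FinS5Alg.{v}) : Type u :=
  {h : (Σ i, Fin (m i)) → Shrink.{0} A.carrier //
    IsLabelling fun w => (equivShrink.{0} A.carrier).symm (h w)}

namespace Labellings

/-- The value of a labelling. -/
noncomputable def val (h : Labellings m A) (w : Σ i, Fin (m i)) : A.carrier :=
  (equivShrink.{0} A.carrier).symm (h.1 w)

theorem isLabelling (h : Labellings m A) : IsLabelling h.val := h.2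

/-- The element given by a labelling. -/
noncomputable def mk (h : (Σ i, Fin (m i)) → A.carrier) (hh : IsLabelling h) : Labellings m A :=
  ⟨fun w => equivShrink.{0} A.carrier (h w), by simpa using hh⟩

@[simp] theorem val_mk (h : (Σ i, Fin (m i)) → A.carrier) (hh : IsLabelling h)
    (w : Σ i, Fin (m i)) : (mk h hh).val w = h w := by
  simp [val, mk]

theorem ext {h k : Labellings m A} (H : ∀ w, h.val w = k.val w) : h = k :=
  Subtype.ext (funext fun w => (equivShrink.{0} A.carrier).symm.injective (H w))

/-- The image of a labelling under a homomorphism. -/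
noncomputable def map (f : A ⟶ B) (h : Labellings m A) : Labellings m B :=
  mk _ (h.isLabelling.map f)

@[simp] theorem val_map (f : A ⟶ B) (h : Labellings m A) (w : Σ i, Fin (m i)) :
    (map f h).val w = f.toBoolHom (h.val w) :=
  val_mk _ _ w

theorem pullback_ext {f : A ⟶ C} {g : B ⟶ C} {x y : Labellings m (FinS5Alg.pullbackObj f g)}
    (h₁ : map (FinS5Alg.pullbackFst f g) x = map (FinS5Alg.pullbackFst f g) y)
    (h₂ : map (FinS5Alg.pullbackSnd f g) x = map (FinS5Alg.pullbackSnd f g) y) : x = y :=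
  ext fun w => FinS5Alg.pullback_ext (by rw [← val_map, ← val_map, h₁])
    (by rw [← val_map, ← val_map, h₂])

theorem exists_of_pullback {f : A ⟶ C} {g : B ⟶ C} (x : Labellings m A) (y : Labellings m B)
    (hxy : map f x = map g y) : ∃ z, map (FinS5Alg.pullbackFst f g) z = x ∧
      map (FinS5Alg.pullbackSnd f g) z = y := by
  choose p hp₁ hp₂ using fun w => FinS5Alg.exists_of_pullback (f := f) (g := g) (x.val w)
    (y.val w) (by rw [← val_map, ← val_map, hxy])
  refine ⟨mk p (.of_pullback ?_ ?_), ext fun w => ?_, ext fun w => ?_⟩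
  · simpa only [hp₁] using x.isLabelling
  · simpa only [hp₂] using y.isLabelling
  · rw [val_map, val_mk, hp₁]
  · rw [val_map, val_mk, hp₂]

end Labellings

variable (m) in
/-- The functor of labellings. -/
noncomputable def labellingFunctor : FinS5Alg.{v} ⥤ Type u where
  obj A := Labellings m A
  map f := ↾(Labellings.map f)
  map_id A := by
    ext h
    exact Labellings.ext fun w => by simp
  map_comp f g := by
    ext h
    exact Labellings.ext fun w => by simp

instance : PreservesFiniteLimits (labellingFunctor.{u, v} m) := by
  have h1 : PreservesLimit (Functor.empty.{0} FinS5Alg.{v}) (labellingFunctor m) := by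
    refine preservesLimit_of_preserves_limit_cone FinS5Alg.isTerminalUnit
      ((isLimitMapConeEmptyConeEquiv _ _).symm ((Types.isTerminalEquivUnique _).symm ?_))
    exact
      { default := Labellings.mk (fun _ => ⊤) (.of_unit _)
        uniq := fun h => Labellings.ext fun w => Subsingleton.elim _ _ }
  have h2 : ∀ {A B C : FinS5Alg.{v}} (f : A ⟶ C) (g : B ⟶ C),
      PreservesLimit (cospan f g) (labellingFunctor m) := by
    intro A B C f g
    have hp := FinS5Alg.isPullback_pullbackObj f g
    refine preservesLimit_of_preserves_limit_cone hp.isLimit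
      ((isLimitMapConePullbackConeEquiv _ hp.w).symm
        (IsPullback.isLimit ((Types.isPullback_iff _ _ _ _).2 ⟨?_, ?_, ?_⟩)))
    · rw [← Functor.map_comp, ← Functor.map_comp, hp.w]
    · exact fun x y h => Labellings.pullback_ext h.1 h.2
    · exact fun x y h => Labellings.exists_of_pullback x y h
  have h3 : PreservesLimitsOfShape (Discrete PEmpty.{1}) (labellingFunctor.{u, v} m) :=
    preservesLimitsOfShape_pempty_of_preservesTerminal _
  have h4 : PreservesLimitsOfShape WalkingCospan (labellingFunctor.{u, v} m) :=
    ⟨fun {K} => preservesLimit_of_iso_diagram _ (diagramIsoCospan K).symm⟩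
  exact preservesFiniteLimits_of_preservesTerminal_and_pullbacks _

/-- The labelling of a powerset algebra given by a surjection. -/
theorem isLabelling_surj {n : ℕ+} (p : Σ i, Surj n (m i)) :
    IsLabelling (A := powAlg.{v} n) fun w : Σ i, Fin (m i) =>
      PowMem.mk fun k => (⟨p.1, p.2.1 k⟩ : Σ i, Fin (m i)) = w where
  inf_eq_bot w w' hw := PowMem.ext fun k => by
    rw [PowMem.inf_iff, PowMem.mk_iff, PowMem.mk_iff]
    exact iff_of_false (fun h => hw (h.1.symm.trans h.2)) (PowMem.not_bot k)
  exists_sup_eq_top := by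
    classical
    refine ⟨Finset.univ.image (Sigma.mk p.1), PowMem.ext fun k => ?_⟩
    rw [PowMem.finset_sup_iff]
    exact iff_of_true ⟨⟨p.1, p.2.1 k⟩, by simp, rfl⟩ (PowMem.top k)
  box_compl i j := PowMem.ext fun k => by
    rw [PowMem.box_iff, PowMem.compl_iff, PowMem.finset_sup_iff]
    simp only [PowMem.compl_iff, PowMem.mk_iff]
    obtain ⟨i', q⟩ := p
    -- On the summand of `p`, surjectivity makes `⟨i, j⟩` occur and every point has a label over
    -- `i`; on the other summands neither happens.
    by_cases h : i' = i
    · subst h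
      obtain ⟨k', hk'⟩ := q.2 j
      refine iff_of_false (fun H => H k' (by rw [← hk'])) fun H => H ⟨q.1 k, by simp, rfl⟩
    · exact iff_of_true (fun k' H => h (congrArg Sigma.fst H))
        fun ⟨k', _, H⟩ => h (congrArg Sigma.fst H)

/-- The first two conditions give each point exactly one label. As `P(n)` has a single class, the
third makes the first component constant and the second one surjective. -/
theorem IsLabelling.exists_surj {n : ℕ+} {h : (Σ i, Fin (m i)) → (powAlg.{v} n).carrier}
    (hh : IsLabelling h) : ∃ p : Σ i, Surj n (m i), ∀ k w,
      PowMem k (h w) ↔ (⟨p.1, p.2.1 k⟩ : Σ i, Fin (m i)) = w := by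
  have hex : ∀ k, ∃ w, PowMem k (h w) := fun k => by
    obtain ⟨s, hs⟩ := hh.exists_sup_eq_top
    obtain ⟨w, -, hw⟩ := (PowMem.finset_sup_iff s h k).1 (hs ▸ PowMem.top k)
    exact ⟨w, hw⟩
  have huniq : ∀ k w w', PowMem k (h w) → PowMem k (h w') → w = w' := fun k w w' hw hw' => by
    by_contra hne
    exact PowMem.not_bot k (hh.inf_eq_bot w w' hne ▸ PowMem.inf_iff.2 ⟨hw, hw'⟩)
  obtain ⟨⟨i, j⟩, hij⟩ := hex ⟨0, n.pos⟩
  -- Read from left to right, this gives every point a label over `i`; from right to left, it makes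
  -- every `⟨i, j'⟩` occur.
  have hbox : ∀ j' k, (∃ k', PowMem k' (h ⟨i, j'⟩)) ↔ ∃ j'', PowMem k (h ⟨i, j''⟩) := by
    intro j' k
    have := iff_of_eq (congrArg (PowMem k) (hh.box_compl i j'))
    rw [PowMem.box_iff, PowMem.compl_iff, PowMem.finset_sup_iff] at this
    simpa [PowMem.compl_iff] using not_congr this
  choose q hq using fun k => (hbox j k).1 ⟨_, hij⟩
  refine ⟨⟨i, q, fun j' => ?_⟩, fun k w => ⟨fun hw => huniq k _ _ (hq k) hw, ?_⟩⟩
  · obtain ⟨k, hk⟩ := (hbox j' _).2 ⟨j, hij⟩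
    exact ⟨k, by simpa using huniq k _ _ (hq k) hk⟩
  · rintro rfl
    exact hq k

variable (m) in
/-- The homomorphism from a sum of representable structures to the restriction of the functor of
labellings. -/
noncomputable def toLabellings :
    LStr.sumRepresentables m ⟶ restrict.obj (labellingFunctor.{u, v} m) :=
  LStr.Hom.mk (fun _ p => Labellings.mk _ (isLabelling_surj p)) fun f p =>
    Labellings.ext fun w => by
      refine (Labellings.val_mk _ _ w).trans (Eq.trans ?_
        (Labellings.val_map (preimageHom f) (Labellings.mk _ (isLabelling_surj p)) w).symm)
      rw [Labellings.val_mk]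
      rfl

theorem toLabellings_bijective (n : ℕ+) :
    Function.Bijective ((toLabellings.{u, v} m).app n) := by
  constructor
  · rintro ⟨i, q⟩ ⟨i', q'⟩ h
    have key : ∀ k, (⟨i, q.1 k⟩ : Σ i, Fin (m i)) = ⟨i', q'.1 k⟩ := by
      intro k
      have h1 := congrArg (fun l : Labellings m (powAlg.{v} n) =>
        PowMem k (l.val ⟨i', q'.1 k⟩)) h
      have h2 := (Labellings.val_mk _ (isLabelling_surj.{u, v} ⟨i, q⟩) ⟨i', q'.1 k⟩)
      have h3 := (Labellings.val_mk _ (isLabelling_surj.{u, v} ⟨i', q'⟩) ⟨i', q'.1 k⟩)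
      refine PowMem.mk_iff.1 (h2 ▸ h1.mpr (h3 ▸ PowMem.mk_iff.2 rfl))
    obtain rfl : i = i' := congrArg Sigma.fst (key ⟨0, n.pos⟩)
    exact congrArg (Sigma.mk i) (Subtype.ext (funext fun k => by simpa using key k))
  · intro h
    obtain ⟨p, hp⟩ := (Labellings.isLabelling h).exists_surj
    refine ⟨p, Labellings.ext fun w => PowMem.ext fun k => ?_⟩
    refine Iff.trans ?_ (hp k w).symm
    exact iff_of_eq (congrArg (PowMem k) (Labellings.val_mk _ (isLabelling_surj p) w))

end Labelling

theorem exists_restrict_iso {M : LStr.{u}} (h : M.Models T₂) :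
    ∃ F : FinS5Alg.{v} ⥤ₗ Type u, Nonempty (restrict.obj F.obj ≅ M) := by
  obtain ⟨I, m, ⟨e⟩⟩ := LStr.exists_iso_sumRepresentables h
  exact ⟨⟨labellingFunctor m, inferInstanceAs (Limits.PreservesFiniteLimits _)⟩,
    ⟨(LStr.isoOfBijective (toLabellings m) toLabellings_bijective).symm ≪≫ e⟩⟩

/-! ### The equivalence -/

/-- Restriction to the powerset algebras, from lex functors to models. -/
noncomputable def restrictLex : (FinS5Alg.{v} ⥤ₗ Type u) ⥤ Theory.Mod.{u} T₂ :=
  ObjectProperty.lift _ (LeftExactFunctor.forget FinS5Alg.{v} (Type u) ⋙ restrict.{u, v})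
    fun F => have := F.property; models_restrict F.obj

instance : (restrictLex.{u, v}).Faithful where
  map_injective {F G} α β h := by
    have := G.property
    exact ObjectProperty.hom_ext _ (eq_of_map_restrict_eq (congrArg (·.hom) h))

instance : (restrictLex.{u, v}).Full where
  map_surjective {F G} φ := by
    have := F.property
    have := G.property
    obtain ⟨α, hα⟩ := exists_map_restrict_eq (G := F.obj) (G' := G.obj) φ.hom
    exact ⟨ObjectProperty.homMk α, ObjectProperty.hom_ext _ hα⟩

instance : (restrictLex.{u, v}).EssSurj where
  mem_essImage M := by
    obtain ⟨F, ⟨e⟩⟩ := exists_restrict_iso.{u, v} M.property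
    exact ⟨F, ⟨ObjectProperty.isoMk _ e⟩⟩

instance : (restrictLex.{u, v}).IsEquivalence where

end S5

theorem mainTheorem1 :
    Limits.HasFiniteLimits S5.FinS5Alg.{v} ∧
    (∃ E : (S5.FinS5Alg.{v} ⥤ₗ Type u) ≌ S5.Theory.Mod.{u} S5.T₂,
      Nonempty (E.functor ⋙ ObjectProperty.ι _ ≅
        LeftExactFunctor.forget S5.FinS5Alg.{v} (Type u) ⋙ S5.restrict.{u, v})) ∧
    (∀ M : S5.LStr.{u}, M.Models S5.T₁ ↔ M.Models S5.T₂) ∧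
    (∀ M : S5.LStr.{u}, M.Models S5.T₂ ↔ ∃ hM : M.IsPresheaf, M.IsUnionOfLiftings hM) :=
  ⟨inferInstance, ⟨S5.restrictLex.asEquivalence, ⟨Iso.refl _⟩⟩,
    fun _ => S5.LStr.models_T₁_iff_models_T₂, fun _ => S5.LStr.models_T₂_iff_isUnionOfLiftings⟩
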